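/- Fix the countable set of variables $\mathbb N$. An NNF is a finite directed acyclic graph with a unique sink (the output gate), whose sources (the input gates) are labeled by constants $0,1$ or literals $x,\neg x$, and whose other gates are labeled by $\wedge$ or $\vee$; its value under an assignment is defined as usual, and its size $\mathrm{size}(C)$ is its number of wires. Two NNFs are equivalent if they have the same value under every assignment. A DNNF is an NNF such that for every $\wedge$-gate the subcircuits leading into it have pairwise disjoint sets of variables. A CNF is an NNF in which the maximum number of wires on a path from an input gate to the output gate is $2$ and every $\vee$-gate has input wires only from input gates; it is monotone if no label is a negative literal, a $2$-CNF if every $\vee$-gate has fanin at most $2$, and read $3$ times if for every variable $x$ of the CNF at most $3$ wires leave gates labeled by $x$ or $\neg x$. For a CNF $F$ let $\mathrm{DNNF}(F)$ be the minimum size of a DNNF equivalent to $F$. For a finite graph $G=(V,E)$ with $V\subseteq\mathbb N$, $|V|\ge 2$ and no isolated vertices, the graph CNF of $G$ is $\bigwedge_{\{x,y\}\in E}(x\vee y)$, with one input gate per vertex, one $\vee$-gate per edge, and an output $\wedge$-gate. For $e>0$, a finite graph $G=(V,E)$ of maximum degree $3$ is an $(e,3)$-expander if every $S\subseteq V$ with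 $|S|\le |V|/2$ has at least $e|S|$ vertices outside $S$ adjacent to a vertex of $S$. **Theorem.** There exist a class $\mathcal C$ of CNF formulas and a constant $c>0$ such that $\mathrm{DNNF}(F)\ge 2^{c\cdot\mathrm{size}(F)}$ for every $F\in\mathcal C$, and every $F\in\mathcal C$ is a read $3$ times monotone $2$-CNF. Moreover, $\mathcal C$ can be taken to be the set of graph CNFs of a sequence $(G_i)_{i\in\mathbb N}$ of $3$-regular graphs $G_i=(V_i,E_i)$ with $V_i\subseteq\mathbb N$, $|V_i|\ge 2$ and no isolated vertices, such that, for some $e>0$, every $G_i$ is an $(e,3)$-expander, and $|V_i|\to\infty$ as $i\to\infty$. -/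

import Mathlib

/-- Labels of the gates of a Boolean circuit in negation normal form: the two constants, the
literals (`lit x true` is the literal `x` and `lit x false` is `¬ x`), and the connectives. -/
inductive GateLabel (X : Type) : Type where
  | const (b : Bool) : GateLabel X
  | lit (x : X) (positive : Bool) : GateLabel X
  | and : GateLabel X
  | or : GateLabel X

/-- The labels allowed on input gates. -/
def GateLabel.IsInput {X : Type} : GateLabel X → Prop
  | .const _ => True
  | .lit _ _ => True
  | .and => False
  | .or => False

/-- A negation normal form over the variables `X`: a finite directed acyclic graph whose unique
sink is the output gate, whose sources are exactly the gates labeled by constants and literals,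
and whose other gates are labeled by a conjunction or a disjunction. `Wire u v` says that there is
a wire from `u` to `v`. -/
structure NNF (X : Type) where
  Gate : Type
  finite_gate : Finite Gate
  Wire : Gate → Gate → Prop
  label : Gate → GateLabel X
  output : Gate
  acyclic : ∀ v, ¬ Relation.TransGen Wire v v
  sink_iff : ∀ v, (∀ w, ¬ Wire v w) ↔ v = output
  source_iff : ∀ v, (∀ u, ¬ Wire u v) ↔ (label v).IsInput

namespace NNF

variable {X : Type}

/-- The number of wires. -/
noncomputable def size (C : NNF X) : ℕ :=
  {p : C.Gate × C.Gate | C.Wire p.1 p.2}.ncard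

/-- `C.Holds f v` says that the subcircuit of `C` sinked at `v` has value `1` under the
assignment `f`. -/
inductive Holds (C : NNF X) (f : X → Bool) : C.Gate → Prop where
  | const (v : C.Gate) (h : C.label v = .const true) : Holds C f v
  | lit (v : C.Gate) (x : X) (b : Bool) (h : C.label v = .lit x b) (hx : f x = b) : Holds C f v
  | and (v : C.Gate) (h : C.label v = .and) (hv : ∀ u, C.Wire u v → Holds C f u) : Holds C f v
  | or (v u : C.Gate) (h : C.label v = .or) (hw : C.Wire u v) (hu : Holds C f u) : Holds C f v

/-- The assignment `f` satisfies the circuit `C`. -/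
def Sat (C : NNF X) (f : X → Bool) : Prop :=
  C.Holds f C.output

/-- Two circuits are equivalent if they have the same value under every assignment. -/
def Equivalent (C D : NNF X) : Prop :=
  ∀ f : X → Bool, C.Sat f ↔ D.Sat f

/-- The variables occurring in the subcircuit of `C` sinked at `v`. -/
def varsAt (C : NNF X) (v : C.Gate) : Set X :=
  {x | ∃ u b, Relation.ReflTransGen C.Wire u v ∧ C.label u = .lit x b}

/-- The variables occurring in `C`. -/
def vars (C : NNF X) : Set X :=
  {x | ∃ u b, C.label u = .lit x b}

/-- A circuit is decomposable (a DNNF) if the subcircuits leading into each conjunction gate have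
pairwise disjoint sets of variables. -/
def IsDNNF (C : NNF X) : Prop :=
  ∀ v, C.label v = .and → ∀ u w, C.Wire u v → C.Wire w v → u ≠ w →
    Disjoint (C.varsAt u) (C.varsAt w)

/-- The size of a smallest DNNF equivalent to `F`. -/
noncomputable def dnnfSize (F : NNF X) : ℕ :=
  sInf {n | ∃ D : NNF X, D.IsDNNF ∧ D.Equivalent F ∧ D.size = n}

/-- There is a directed path with exactly the given number of wires. -/
def HasPath (C : NNF X) : ℕ → C.Gate → C.Gate → Prop
  | 0, u, v => u = v
  | n + 1, u, v => ∃ w, C.Wire u w ∧ HasPath C n w v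

/-- A CNF is an NNF in which the maximum number of wires on a path from an input gate to the
output gate is `2`, and each disjunction gate has input wires only from input gates. -/
def IsCNF (C : NNF X) : Prop :=
  IsGreatest {n | ∃ u, (C.label u).IsInput ∧ C.HasPath n u C.output} 2 ∧
    ∀ u v, C.label v = .or → C.Wire u v → (C.label u).IsInput

/-- No gate is labeled by a negative literal. -/
def IsMonotone (C : NNF X) : Prop :=
  ∀ v x, C.label v ≠ .lit x false

/-- A `k`-CNF: the fanin of the disjunction gates is at most `k`. -/
def IsKCNF (C : NNF X) (k : ℕ) : Prop :=
  C.IsCNF ∧ ∀ v, C.label v = .or → {u | C.Wire u v}.ncard ≤ k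

/-- A read `k` times CNF: at most `k` wires leave the gates whose label contains a given
variable. -/
def IsReadTimes (C : NNF X) (k : ℕ) : Prop :=
  C.IsCNF ∧ ∀ x ∈ C.vars,
    {p : C.Gate × C.Gate | C.Wire p.1 p.2 ∧ ∃ b, C.label p.1 = .lit x b}.ncard ≤ k

end NNF

section Graphs

/-- The open neighbourhood of a set of vertices. -/
def openNeighbourhood {V : Type} (G : SimpleGraph V) (S : Finset V) : Set V :=
  {v | v ∉ S ∧ ∃ u ∈ S, G.Adj u v}

open Classical in
/-- A `(c, d)`-expander: a graph of (maximum) degree `d ≥ 3` in which every set `S` of at most half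
of the vertices has at least `c * |S|` vertices in its open neighbourhood, where `c > 0`. -/
def IsExpander {V : Type} [Fintype V] (G : SimpleGraph V) (c : ℝ) (d : ℕ) : Prop :=
  3 ≤ d ∧ 0 < c ∧ G.maxDegree = d ∧
    ∀ S : Finset V, 2 * S.card ≤ Fintype.card V → c * S.card ≤ (openNeighbourhood G S).ncard

open Classical in
/-- Every vertex has degree `3`. -/
def IsCubic {V : Type} [Fintype V] (G : SimpleGraph V) : Prop :=
  G.IsRegularOfDegree 3

variable {X : Type} {V : Finset X}

/-- The gates of a graph CNF: an input gate for every vertex, a disjunction gate for every edge,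
and the output gate. -/
abbrev GraphGate (G : SimpleGraph V) : Type := V ⊕ G.edgeSet ⊕ Unit

/-- The wires of a graph CNF: from a vertex to the edges containing it, and from every edge to the
output gate. -/
def graphWire (G : SimpleGraph V) : GraphGate G → GraphGate G → Prop
  | .inl v, .inr (.inl e) => v ∈ (e : Sym2 V)
  | .inr (.inl _), .inr (.inr _) => True
  | _, _ => False

/-- The labels of a graph CNF; the variable of a vertex is the vertex itself. -/
def graphLabel (G : SimpleGraph V) : GraphGate G → GateLabel X
  | .inl v => .lit v.1 true
  | .inr (.inl _) => .or
  | .inr (.inr _) => .and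

def graphRank (G : SimpleGraph V) : GraphGate G → ℕ
  | .inl _ => 0
  | .inr (.inl _) => 1
  | .inr (.inr _) => 2

theorem graphRank_lt (G : SimpleGraph V) (u v : GraphGate G) (h : graphWire G u v) :
    graphRank G u < graphRank G v := by
  rcases u with u | u | u <;> rcases v with v | v | v <;> simp_all [graphWire, graphRank]

/-- The graph CNF of a graph with at least two vertices and no isolated vertices, whose vertices
are variables: the conjunction of the clauses `x ∨ y` over all edges `{x, y}`. -/
def graphCNF (G : SimpleGraph V) (hV : 2 ≤ V.card) (hG : ∀ v, ∃ w, G.Adj v w) : NNF X where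
  Gate := GraphGate G
  finite_gate := inferInstance
  Wire := graphWire G
  label := graphLabel G
  output := .inr (.inr ())
  acyclic := by
    have key : ∀ u v, Relation.TransGen (graphWire G) u v → graphRank G u < graphRank G v := by
      intro u v h
      induction h with
      | single h => exact graphRank_lt G _ _ h
      | tail _ h ih => exact ih.trans (graphRank_lt G _ _ h)
    exact fun v h => lt_irrefl _ (key v v h)
  sink_iff := by
    rintro (v | e | u)
    · obtain ⟨w, hw⟩ := hG v
      simp only [reduceCtorEq, iff_false, not_forall, not_not]
      exact ⟨.inr (.inl ⟨s(v, w), hw⟩), Sym2.mem_mk_left v w⟩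
    · simp only [Sum.inr.injEq, reduceCtorEq, iff_false, not_forall, not_not]
      exact ⟨.inr (.inr ()), trivial⟩
    · simp only [iff_true]
      rintro (w | w | w) h <;> exact h
  source_iff := by
    rintro (v | ⟨e, he⟩ | u)
    · simp only [graphLabel, GateLabel.IsInput, iff_true]
      rintro (w | w | w) h <;> exact h
    · simp only [graphLabel, GateLabel.IsInput, iff_false, not_forall, not_not]
      induction e with
      | h v w => exact ⟨.inl v, Sym2.mem_mk_left v w⟩
    · simp only [graphLabel, GateLabel.IsInput, iff_false, not_forall, not_not]
      obtain ⟨x, hx⟩ := Finset.card_pos.mp (lt_of_lt_of_le two_pos hV)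
      obtain ⟨w, hw⟩ := hG ⟨x, hx⟩
      exact ⟨.inr (.inl ⟨s(⟨x, hx⟩, w), hw⟩), trivial⟩

end Graphs

/-! ### Rectangles from the wires of a DNNF -/

namespace NNF

variable {X : Type}

theorem Holds.congr {C : NNF X} {f g : X → Bool} {v : C.Gate} (h : C.Holds f v)
    (hfg : ∀ x ∈ C.varsAt v, f x = g x) : C.Holds g v := by
  induction h with
  | const v h => exact .const v h
  | lit v x b h hx => exact .lit v x b h (by rw [← hfg x ⟨v, b, .refl, h⟩, hx])
  | and v h hv ih =>
    refine .and v h fun u hu => ih u hu fun x hx => hfg x ?_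
    obtain ⟨t, b, ht, hl⟩ := hx
    exact ⟨t, b, ht.tail hu, hl⟩
  | or v u h hw hu ih =>
    refine .or v u h hw (ih fun x hx => hfg x ?_)
    obtain ⟨t, b, ht, hl⟩ := hx
    exact ⟨t, b, ht.tail hw, hl⟩

theorem varsAt_mono {C : NNF X} {u v : C.Gate} (h : Relation.ReflTransGen C.Wire u v) :
    C.varsAt u ⊆ C.varsAt v := by
  rintro x ⟨t, b, ht, hl⟩
  exact ⟨t, b, ht.trans h, hl⟩

theorem varsAt_wire {C : NNF X} {u v : C.Gate} (h : C.Wire u v) : C.varsAt u ⊆ C.varsAt v :=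
  varsAt_mono (.single h)

theorem isInput_no_wire {C : NNF X} {v : C.Gate} (h : (C.label v).IsInput) (u : C.Gate) :
    ¬ C.Wire u v :=
  (C.source_iff v).2 h u

theorem eq_of_mem_varsAt_input {C : NNF X} {v : C.Gate} (h : (C.label v).IsInput) {x : X}
    (hx : x ∈ C.varsAt v) : ∃ b, C.label v = .lit x b := by
  obtain ⟨t, b, ht, hl⟩ := hx
  rcases Relation.ReflTransGen.cases_tail ht with rfl | ⟨w, _, hw⟩
  · exact ⟨b, hl⟩
  · exact absurd hw (isInput_no_wire h w)

theorem subsingleton_varsAt_input {C : NNF X} {v : C.Gate} (h : (C.label v).IsInput) :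
    (C.varsAt v).Subsingleton := by
  intro x hx y hy
  obtain ⟨b, hb⟩ := eq_of_mem_varsAt_input h hx
  obtain ⟨c, hc⟩ := eq_of_mem_varsAt_input h hy
  rw [hb] at hc
  exact (GateLabel.lit.inj hc).1

theorem mem_varsAt_and_or {C : NNF X} {v : C.Gate} (h : ¬ (C.label v).IsInput) {x : X}
    (hx : x ∈ C.varsAt v) : ∃ u, C.Wire u v ∧ x ∈ C.varsAt u := by
  obtain ⟨t, b, ht, hl⟩ := hx
  rcases Relation.ReflTransGen.cases_tail ht with rfl | ⟨w, hw, hwv⟩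
  · exact absurd (by rw [hl]; trivial) h
  · exact ⟨w, hwv, t, b, hw, hl⟩

/-- `C.Context g v w` says that some derivation of the value `1` at `w` under the assignment `g`
visits `v`, up to the value of the subcircuit sinked at `v`. -/
inductive Context (C : NNF X) (g : X → Bool) (v : C.Gate) : C.Gate → Prop where
  | refl : Context C g v v
  | or (u w : C.Gate) (h : C.label w = .or) (hw : C.Wire u w) (hu : Context C g v u) :
      Context C g v w
  | and (u w : C.Gate) (h : C.label w = .and) (hw : C.Wire u w) (hu : Context C g v u)
      (ho : ∀ t, C.Wire t w → C.Holds g t) : Context C g v w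

theorem Context.reflTransGen {C : NNF X} {g : X → Bool} {v w : C.Gate} (h : C.Context g v w) :
    Relation.ReflTransGen C.Wire v w := by
  induction h with
  | refl => exact .refl
  | or u w _ hw _ ih => exact ih.tail hw
  | and u w _ hw _ _ ih => exact ih.tail hw

open Classical in
/-- In a decomposable circuit, changing an assignment on variables of a subcircuit does not affect
the context of that subcircuit. -/
theorem Context.holds_piecewise {C : NNF X} (hC : C.IsDNNF) {f g : X → Bool} {v w : C.Gate}
    (h : C.Context g v w) {A : Set X} (hA : A ⊆ C.varsAt v) (hv : C.Holds (A.piecewise f g) v) :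
    C.Holds (A.piecewise f g) w := by
  induction h with
  | refl => exact hv
  | or u w hl hw _ ih => exact .or w u hl hw ih
  | and u w hl hw hu ho ih =>
    refine .and w hl fun t ht => ?_
    rcases eq_or_ne t u with rfl | htu
    · exact ih
    -- The other inputs `t` keep the value they have under `g`: by decomposability their variables
    -- avoid those below `u`, which include `A`.
    · refine (ho t ht).congr fun x hx => ?_
      have hxA : x ∉ A := fun hxA =>
        Set.disjoint_left.1 (hC w hl t u ht hw htu) hx (varsAt_mono hu.reflTransGen (hA hxA))
      rw [Set.piecewise_eq_of_notMem _ _ _ hxA]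

open Classical in
/-- The variables of `V` occurring in the subcircuit sinked at `v`. -/
noncomputable def localVars (C : NNF X) (V : Finset X) (v : C.Gate) : Finset X :=
  V.filter (· ∈ C.varsAt v)

/-- A gate is heavy if more than two thirds of the variables in `V` occur below it. -/
def Heavy (C : NNF X) (V : Finset X) (v : C.Gate) : Prop :=
  2 * V.card < 3 * (C.localVars V v).card

/-- A heavy gate `w`, reached by a derivation of `f`, at which the derivation stops being heavy. -/
def Splits (C : NNF X) (V : Finset X) (f : X → Bool) (u w : C.Gate) : Prop :=
  C.Heavy V w ∧ C.Wire u w ∧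
    ((C.label w = .or ∧ ¬ C.Heavy V u ∧ C.Holds f u) ∨
      (C.label w = .and ∧ ∀ t, C.Wire t w → ¬ C.Heavy V t ∧ C.Holds f t))

theorem not_heavy_input {C : NNF X} {V : Finset X} (hV : 2 ≤ V.card) {v : C.Gate}
    (h : (C.label v).IsInput) : ¬ C.Heavy V v := by
  have : (C.localVars V v).card ≤ 1 := by
    refine Finset.card_le_one.2 fun x hx y hy => ?_
    simp only [localVars, Finset.mem_filter] at hx hy
    exact subsingleton_varsAt_input h hx.2 hy.2
  unfold Heavy
  omega

/-- Descend along the derivation to a heavy input as long as there is one. Input gates carry at most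
one variable and so are not heavy, which forces a stop before them. -/
theorem Holds.exists_splits {C : NNF X} {V : Finset X} (hV : 2 ≤ V.card) {f : X → Bool}
    {v : C.Gate} (h : C.Holds f v) (hv : C.Heavy V v) :
    ∃ u w, C.Splits V f u w ∧ C.Context f w v := by
  induction h with
  | const v h => exact absurd hv (not_heavy_input hV (by rw [h]; trivial))
  | lit v x b h hx => exact absurd hv (not_heavy_input hV (by rw [h]; trivial))
  | or v u h hw hu ih =>
    by_cases hh : C.Heavy V u
    · obtain ⟨t, w, hs, hc⟩ := ih hh
      exact ⟨t, w, hs, .or u v h hw hc⟩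
    · exact ⟨u, v, ⟨hv, hw, .inl ⟨h, hh, hu⟩⟩, .refl⟩
  | and v h hu ih =>
    by_cases hh : ∃ u, C.Wire u v ∧ C.Heavy V u
    · obtain ⟨u, hw, hh⟩ := hh
      obtain ⟨t, w, hs, hc⟩ := ih u hw hh
      exact ⟨t, w, hs, .and u v h hw hc hu⟩
    · push Not at hh
      have : ∃ u, C.Wire u v := by
        by_contra hn
        push Not at hn
        have := (C.source_iff v).1 hn
        rw [h] at this
        exact this
      obtain ⟨u, hw⟩ := this
      exact ⟨u, v, ⟨hv, hw, .inr ⟨h, fun t ht => ⟨hh t ht, hu t ht⟩⟩⟩, .refl⟩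

open Classical in
/-- A weight function on subsets with small singletons takes a middle value. -/
theorem exists_balanced_subset {α β : Type} (s : Finset α) (F : α → Finset β) (n : ℕ)
    (hs : 2 * n < 3 * (s.biUnion F).card) (hF : ∀ a ∈ s, 3 * (F a).card ≤ 2 * n) :
    ∃ t ⊆ s, n ≤ 3 * (t.biUnion F).card ∧ 3 * (t.biUnion F).card ≤ 2 * n := by
  -- Take the fewest sets whose union reaches a third. If it exceeded two thirds, dropping any `a`
  -- would fall below a third, so `F a` alone would exceed a third; minimality then leaves only `a`,
  -- against `hF`.
  obtain ⟨t, ht, hmin⟩ := Finset.exists_min_image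
    (s.powerset.filter fun t => n ≤ 3 * (t.biUnion F).card) Finset.card
    ⟨s, by simp only [Finset.mem_filter, Finset.mem_powerset, subset_refl, true_and]; omega⟩
  simp only [Finset.mem_filter, Finset.mem_powerset] at ht hmin
  refine ⟨t, ht.1, ht.2, ?_⟩
  by_contra hlt
  push Not at hlt
  obtain ⟨a, ha⟩ : t.Nonempty := by
    rw [Finset.nonempty_iff_ne_empty]
    rintro rfl
    simp at hlt
  have h1 : ¬ n ≤ 3 * ((t.erase a).biUnion F).card := fun h => by
    have := hmin (t.erase a) ⟨(Finset.erase_subset _ _).trans ht.1, h⟩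
    have := Finset.card_erase_lt_of_mem ha
    omega
  have h2 : t.biUnion F = F a ∪ (t.erase a).biUnion F := by
    rw [← Finset.biUnion_insert, Finset.insert_erase ha]
  have h3 : (t.biUnion F).card ≤ (F a).card + ((t.erase a).biUnion F).card := by
    rw [h2]; exact Finset.card_union_le _ _
  have h4 := hmin {a} ⟨by simpa using ht.1 ha, by rw [Finset.singleton_biUnion]; omega⟩
  obtain ⟨b, hb⟩ := Finset.card_eq_one.1
    (le_antisymm (by simpa using h4) (Finset.card_pos.2 ⟨a, ha⟩))
  have := hF a (ht.1 ha)
  rw [hb] at ha hlt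
  rw [Finset.mem_singleton] at ha
  rw [Finset.singleton_biUnion, ← ha] at hlt
  omega

open Classical in
/-- A wire of a decomposable circuit determines a balanced partition of the variables for which
the assignments splitting at the wire form a combinatorial rectangle. -/
theorem exists_balanced_mixing {C : NNF X} (hC : C.IsDNNF) {V : Finset X} (hV : 2 ≤ V.card)
    (u w : C.Gate) (hs : ∃ f, C.Splits V f u w) :
    ∃ A : Set X, V.card ≤ 3 * (V.filter (· ∈ A)).card ∧
      3 * (V.filter (· ∈ A)).card ≤ 2 * V.card ∧
      ∀ f g, C.Splits V f u w → C.Splits V g u w → C.Context g w C.output →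
        C.Sat (A.piecewise f g) := by
  obtain ⟨f₀, hw, huw, hf₀⟩ := hs
  rcases hf₀ with ⟨hl, hu, -⟩ | ⟨hl, hu⟩
  · have hsub : C.localVars V u ⊆ C.localVars V w := fun x hx => by
      simp only [localVars, Finset.mem_filter] at hx ⊢
      exact ⟨hx.1, varsAt_wire huw hx.2⟩
    unfold Heavy at hw hu
    -- The light gate `u` may have less than a third of the variables below it, so variables from
    -- below `w` are added up to a third rounded up; `2 ≤ V.card` keeps this within two thirds.
    obtain ⟨B, hB₁, hB₂, hB₃⟩ := Finset.exists_subsuperset_card_eq hsub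
      (n := max (C.localVars V u).card ((V.card + 2) / 3)) (le_max_left _ _)
      (max_le (Finset.card_le_card hsub) (by omega))
    -- Variables below `u` outside `V` must also be in `A`, so that the mixture agrees with `f` on
    -- the whole subcircuit.
    obtain ⟨A, hmem⟩ : ∃ A : Set X, ∀ x, x ∈ A ↔ x ∈ C.varsAt u ∨ x ∈ B :=
      ⟨C.varsAt u ∪ B, fun _ => Iff.rfl⟩
    have hA : V.filter (· ∈ A) = B := by
      ext x
      rw [Finset.mem_filter, hmem]
      refine ⟨?_, fun hx => ⟨(Finset.mem_filter.1 (hB₂ hx)).1, .inr hx⟩⟩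
      rintro ⟨hx, hx' | hx'⟩
      · exact hB₁ (Finset.mem_filter.2 ⟨hx, hx'⟩)
      · exact hx'
    refine ⟨A, ?_, ?_, ?_⟩
    · rw [hA, hB₃]; omega
    · rw [hA, hB₃]; omega
    · rintro f g ⟨-, -, hf⟩ - hc
      refine hc.holds_piecewise hC (fun x hx => ((hmem x).1 hx).elim (fun h => varsAt_wire huw h)
        fun h => (Finset.mem_filter.1 (hB₂ h)).2) ?_
      have hf : C.Holds f u := by
        rcases hf with h | h
        · exact h.2.2
        · exact (h.2 u huw).2
      exact .or w u hl huw (hf.congr fun x hx =>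
        (Set.piecewise_eq_of_mem _ _ _ ((hmem x).2 (.inl hx))).symm)
  · have := C.finite_gate
    have := Fintype.ofFinite C.Gate
    have hbi : ∀ t : Finset C.Gate,
        V.filter (· ∈ ⋃ a ∈ t, C.varsAt a) = t.biUnion (C.localVars V) := fun t => by
      ext x
      simp only [localVars, Finset.mem_filter, Set.mem_iUnion, Finset.mem_biUnion, exists_prop]
      tauto
    -- All inputs of `w` are light but together heavy, so some of them carry a balanced share. These
    -- take their values from `f`, the others from `g`, without conflict by decomposability.
    obtain ⟨t, ht, h1, h2⟩ := exists_balanced_subset (Finset.univ.filter (C.Wire · w))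
      (C.localVars V) V.card (by
        refine lt_of_lt_of_le hw (Nat.mul_le_mul_left 3 (Finset.card_le_card fun x hx => ?_))
        simp only [localVars, Finset.mem_filter] at hx
        obtain ⟨a, ha, hxa⟩ := mem_varsAt_and_or (by rw [hl]; exact id) hx.2
        simp only [localVars, Finset.mem_biUnion, Finset.mem_filter, Finset.mem_univ, true_and]
        exact ⟨a, ha, hx.1, hxa⟩)
      (fun a ha => by
        have := (hu a (Finset.mem_filter.1 ha).2).1
        unfold Heavy at this
        omega)
    have htw : ∀ a ∈ t, C.Wire a w := fun a ha => (Finset.mem_filter.1 (ht ha)).2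
    refine ⟨⋃ a ∈ t, C.varsAt a, by rwa [hbi], by rwa [hbi], ?_⟩
    rintro f g ⟨-, -, hf⟩ ⟨-, -, hg⟩ hc
    have key : ∀ f, ((C.label w = .or ∧ ¬ C.Heavy V u ∧ C.Holds f u) ∨
      (C.label w = .and ∧ ∀ t, C.Wire t w → ¬ C.Heavy V t ∧ C.Holds f t)) →
        ∀ t, C.Wire t w → C.Holds f t := by
      rintro f (h | h) a ha
      · rw [hl] at h; exact absurd h.1 (by simp)
      · exact (h.2 a ha).2
    refine hc.holds_piecewise hC
      (Set.iUnion₂_subset fun a ha => varsAt_wire (htw a ha)) (.and w hl fun a ha => ?_)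
    by_cases hat : a ∈ t
    · exact (key f hf a ha).congr fun x hx =>
        (Set.piecewise_eq_of_mem _ _ _ (Set.mem_biUnion hat hx)).symm
    · refine (key g hg a ha).congr fun x hx => (Set.piecewise_eq_of_notMem _ _ _ ?_).symm
      simp only [Set.mem_iUnion, not_exists]
      intro b hb hxb
      exact Set.disjoint_left.1 (hC w hl a b ha (htw b hb) fun h => hat (h ▸ hb)) hx hxb

/-- The rectangle attached to a wire. -/
def wireRectangle (C : NNF X) (V : Finset X) (p : C.Gate × C.Gate) : Set (X → Bool) :=
  {f | C.Splits V f p.1 p.2 ∧ C.Context f p.2 C.output}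

open Classical in
/-- The models of a decomposable circuit are covered by balanced rectangles, one for each wire. -/
theorem exists_rectangle_cover {C : NNF X} (hC : C.IsDNNF) {V : Finset X} (hV : 2 ≤ V.card)
    (hvars : (V : Set X) ⊆ C.varsAt C.output) :
    (∀ f, C.Sat f → ∃ p : C.Gate × C.Gate, C.Wire p.1 p.2 ∧ f ∈ C.wireRectangle V p) ∧
    ∀ p, (C.wireRectangle V p).Nonempty → ∃ A : Set X,
      V.card ≤ 3 * (V.filter (· ∈ A)).card ∧ 3 * (V.filter (· ∈ A)).card ≤ 2 * V.card ∧
      ∀ f ∈ C.wireRectangle V p, ∀ g ∈ C.wireRectangle V p, C.Sat (A.piecewise f g) := by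
  constructor
  · intro f hf
    have hheavy : C.Heavy V C.output := by
      unfold Heavy localVars
      rw [Finset.filter_true_of_mem fun x hx => hvars hx]
      omega
    obtain ⟨u, w, hs, hc⟩ := Holds.exists_splits hV hf hheavy
    exact ⟨(u, w), hs.2.1, hs, hc⟩
  · rintro p ⟨f, hf, -⟩
    obtain ⟨A, h1, h2, h3⟩ := exists_balanced_mixing hC hV p.1 p.2 ⟨f, hf⟩
    exact ⟨A, h1, h2, fun f hf g hg => h3 f g hf.1 hg.1 hg.2⟩

end NNF

/-! ### Counting vertex covers, and cuts in expanders -/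

section VertexCovers

open Classical in
/-- The vertex covers of `G` that contain `T`. -/
noncomputable def coversContaining {W : Type} [Fintype W] (G : SimpleGraph W) (T : Finset W) :
    Finset (Finset W) :=
  Finset.univ.filter fun C => (∀ v w, G.Adj v w → v ∈ C ∨ w ∈ C) ∧ T ⊆ C

variable {W : Type} [Fintype W] {G : SimpleGraph W}

theorem mem_coversContaining {T C : Finset W} :
    C ∈ coversContaining G T ↔ (∀ v w, G.Adj v w → v ∈ C ∨ w ∈ C) ∧ T ⊆ C := by
  simp [coversContaining]

open Classical in
-- Trading `t` for all its neighbours turns a cover with `t` into one without. The original is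
-- recovered from its trace on the neighbourhood of `t`, so at most `2 ^ d` covers share an image.
theorem card_coversContaining_insert {d : ℕ} {T : Finset W} {t : W} (ht : t ∉ T)
    (hd : G.degree t ≤ d) :
    (2 ^ d + 1) * (coversContaining G (insert t T)).card ≤
      2 ^ d * (coversContaining G T).card := by
  have h1 : (coversContaining G (insert t T)).card ≤
      ((coversContaining G T).filter (t ∉ ·)).card * 2 ^ d := by
    calc _ ≤ (((coversContaining G T).filter (t ∉ ·)) ×ˢ (G.neighborFinset t).powerset).card := by
          refine Finset.card_le_card_of_injOn
            (fun C => ((C ∪ G.neighborFinset t).erase t, C ∩ G.neighborFinset t)) ?_ ?_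
          · intro C hC
            rw [Finset.mem_coe, mem_coversContaining] at hC
            simp only [Finset.coe_product, Set.mem_prod, Finset.mem_coe, Finset.mem_filter,
              mem_coversContaining, Finset.mem_powerset]
            refine ⟨⟨⟨fun v w hvw => ?_, fun x hx => ?_⟩, Finset.notMem_erase _ _⟩,
              Finset.inter_subset_right⟩
            · simp only [Finset.mem_erase, Finset.mem_union, SimpleGraph.mem_neighborFinset]
              have := hC.1 v w hvw
              have := hvw.ne
              by_cases hv : v = t
              · subst hv
                exact .inr ⟨hvw.ne', .inr hvw⟩
              · by_cases hw : w = t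
                · subst hw
                  exact .inl ⟨hvw.ne, .inr hvw.symm⟩
                · tauto
            · have := hC.2 (Finset.mem_insert_of_mem hx)
              simp only [Finset.mem_erase, Finset.mem_union]
              exact ⟨fun h => ht (h ▸ hx), .inl this⟩
          · intro C hC C' hC' h
            rw [Finset.mem_coe, mem_coversContaining] at hC hC'
            simp only [Prod.mk.injEq] at h
            ext x
            have h1 := Finset.ext_iff.1 h.1 x
            have h2 := Finset.ext_iff.1 h.2 x
            have h3 := hC.2 (Finset.mem_insert_self t T)
            have h4 := hC'.2 (Finset.mem_insert_self t T)
            simp only [Finset.mem_erase, Finset.mem_union, Finset.mem_inter] at h1 h2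
            by_cases hx : x = t
            · subst hx; tauto
            · tauto
      _ ≤ _ := by
          rw [Finset.card_product, Finset.card_powerset, SimpleGraph.card_neighborFinset_eq_degree]
          exact Nat.mul_le_mul_left _ (Nat.pow_le_pow_right two_pos hd)
  have h2 : (coversContaining G T).card = ((coversContaining G T).filter (t ∉ ·)).card +
      (coversContaining G (insert t T)).card := by
    rw [← Finset.card_filter_add_card_filter_not (s := coversContaining G T) (p := (t ∉ ·))]
    congr 2
    ext C
    simp only [Finset.mem_filter, mem_coversContaining, Finset.insert_subset_iff, not_not]
    tauto
  rw [h2]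
  linarith

open Classical in
theorem card_coversContaining_le {d : ℕ} (hd : ∀ t, G.degree t ≤ d) (T : Finset W) :
    (2 ^ d + 1) ^ T.card * (coversContaining G T).card ≤
      (2 ^ d) ^ T.card * (coversContaining G ∅).card := by
  induction T using Finset.induction_on with
  | empty => simp
  | insert t T ht ih =>
    rw [Finset.card_insert_of_notMem ht, pow_succ, pow_succ]
    calc _ = (2 ^ d + 1) ^ T.card * ((2 ^ d + 1) * (coversContaining G (insert t T)).card) := by
          ring
      _ ≤ (2 ^ d + 1) ^ T.card * (2 ^ d * (coversContaining G T).card) :=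
          Nat.mul_le_mul_left _ (card_coversContaining_insert ht (hd t))
      _ = 2 ^ d * ((2 ^ d + 1) ^ T.card * (coversContaining G T).card) := by ring
      _ ≤ 2 ^ d * ((2 ^ d) ^ T.card * (coversContaining G ∅).card) := Nat.mul_le_mul_left _ ih
      _ = _ := by ring

open Classical in
/-- In an expander, a set of vertices touching all edges across a balanced cut is large. -/
theorem IsExpander.card_le_of_touches_cut {e : ℝ} {d : ℕ} (hG : IsExpander G e d)
    (A T : Finset W) (h1 : Fintype.card W ≤ 3 * A.card) (h2 : 3 * A.card ≤ 2 * Fintype.card W)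
    (hT : ∀ a ∈ A, ∀ b ∉ A, G.Adj a b → a ∈ T ∨ b ∈ T) :
    e * Fintype.card W ≤ 3 * (d + 1) * T.card := by
  obtain ⟨-, he, hd, hexp⟩ := hG
  have key : ∀ S : Finset W, 2 * S.card ≤ Fintype.card W → Fintype.card W ≤ 3 * S.card →
      (∀ a ∈ S, ∀ b ∉ S, G.Adj a b → a ∈ T ∨ b ∈ T) →
      e * Fintype.card W ≤ 3 * (d + 1) * T.card := by
    intro S hS hS' hST
    -- Every outside neighbour of `S` is in `T` or adjacent to a member of `T`, hence there are at
    -- most `(d + 1) * T.card` of them.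
    have hsub : openNeighbourhood G S ⊆
        (T.biUnion fun t => insert t (G.neighborFinset t) : Finset W) := by
      rintro v ⟨hv, u, hu, huv⟩
      simp only [Finset.coe_biUnion, Set.mem_iUnion, Finset.mem_coe, Finset.mem_insert,
        SimpleGraph.mem_neighborFinset, exists_prop]
      rcases hST u hu v hv huv with h | h
      · exact ⟨u, h, .inr huv⟩
      · exact ⟨v, h, .inl rfl⟩
    have hcard : (openNeighbourhood G S).ncard ≤ T.card * (d + 1) := by
      refine (Set.ncard_le_ncard hsub (Finset.finite_toSet _)).trans ?_
      rw [Set.ncard_coe_finset]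
      refine Finset.card_biUnion_le_card_mul _ _ _ fun t _ => (Finset.card_insert_le _ _).trans ?_
      rw [SimpleGraph.card_neighborFinset_eq_degree, ← hd]
      exact Nat.succ_le_succ (G.degree_le_maxDegree t)
    have h3 := hexp S hS
    have h4 : ((openNeighbourhood G S).ncard : ℝ) ≤ T.card * (d + 1) := by exact_mod_cast hcard
    have h5 : (Fintype.card W : ℝ) ≤ 3 * S.card := by exact_mod_cast hS'
    nlinarith
  by_cases hA : 2 * A.card ≤ Fintype.card W
  · exact key A hA h1 hT
  · have := Finset.card_add_card_compl A
    refine key Aᶜ (by omega) (by omega) fun a ha b hb hab => ?_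
    rw [Finset.mem_compl] at ha hb
    exact (hT b (not_not.1 hb) a ha hab.symm).symm

end VertexCovers

/-! ### The exponential lower bound on the number of wires -/

namespace NNF

variable {X : Type} {V : Finset X}

open Classical in
/-- The assignment of a set of vertices. -/
noncomputable def coverAssignment (C : Finset V) (x : X) : Bool :=
  decide (∃ v ∈ C, (v : X) = x)

theorem coverAssignment_coe (C : Finset V) (v : V) : coverAssignment C v = true ↔ v ∈ C := by
  simp only [coverAssignment, decide_eq_true_eq]
  exact ⟨fun ⟨w, hw, h⟩ => Subtype.ext h ▸ hw, fun h => ⟨v, h, rfl⟩⟩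

/-- `D` computes the conjunction of the clauses `x ∨ y` over all edges of `G`. -/
def Computes (D : NNF X) (G : SimpleGraph V) : Prop :=
  ∀ f, D.Sat f ↔ ∀ v w, G.Adj v w → f v = true ∨ f w = true

/-- Were `x` absent from `D`, then in the model false only at a neighbour `y` the value of `x` could
be switched to false unnoticed, falsifying the edge between them. -/
theorem Computes.vertices_subset {D : NNF X} {G : SimpleGraph V} (h : D.Computes G)
    (hG : ∀ v, ∃ w, G.Adj v w) : (V : Set X) ⊆ D.varsAt D.output := by
  classical
  intro x hx
  obtain ⟨y, hy⟩ := hG ⟨x, hx⟩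
  by_contra hn
  have h1 : D.Sat fun z => decide (z ≠ y) := (h _).2 fun v w hvw => by
    have := hvw.ne
    simp only [ne_eq, decide_eq_true_eq, Subtype.coe_inj]
    by_contra hc
    push Not at hc
    exact this (hc.1.trans hc.2.symm)
  have h2 : D.Sat fun z => decide (z ≠ y ∧ z ≠ x) := h1.congr fun z hz => by
    have : z ≠ x := fun h => hn (h ▸ hz)
    simp [this]
  have := (h _).1 h2 ⟨x, hx⟩ y hy
  simp at this

open Classical in
-- All covers at the wire contain the set `T` of vertices true throughout its rectangle. Mixing
-- shows that `T` touches every edge of a balanced cut, so `T` is large and covers containing it are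
-- rare.
theorem Computes.rectangle_card_le {D : NNF X} (hD : D.IsDNNF) {G : SimpleGraph V}
    (h : D.Computes G) (hV : 2 ≤ V.card) (hG : ∀ v, ∃ w, G.Adj v w) {e : ℝ} {d : ℕ}
    (hexp : IsExpander G e d) (p : D.Gate × D.Gate) :
    (((coversContaining G ∅).filter fun C => coverAssignment C ∈ D.wireRectangle V p).card : ℝ) *
        ((2 ^ d + 1) / 2 ^ d : ℝ) ^ (e * V.card / (3 * (d + 1))) ≤
      (coversContaining G ∅).card := by
  rcases Set.eq_empty_or_nonempty (D.wireRectangle V p) with hp | hp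
  · simp [hp]
  obtain ⟨A, hA1, hA2, hA⟩ :=
    (exists_rectangle_cover hD hV (h.vertices_subset hG)).2 p hp
  let T : Finset V := Finset.univ.filter fun v => ∀ f ∈ D.wireRectangle V p, f v = true
  let B : Finset V := Finset.univ.filter fun v => (v : X) ∈ A
  have hB : B.card = (V.filter (· ∈ A)).card := by
    rw [← Finset.card_map (Function.Embedding.subtype (· ∈ V))]
    congr 1
    ext x
    simp [B, and_comm]
  have hT : e * V.card ≤ 3 * (d + 1) * T.card := by
    rw [← Fintype.card_coe V]
    refine hexp.card_le_of_touches_cut B T (by rw [hB, Fintype.card_coe]; exact hA1)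
      (by rw [hB, Fintype.card_coe]; exact hA2) fun a ha b hb hab => ?_
    simp only [B, T, Finset.mem_filter, Finset.mem_univ, true_and] at ha hb ⊢
    by_contra hcon
    push Not at hcon
    obtain ⟨⟨f, hf, hfa⟩, g, hg, hgb⟩ := hcon
    have := (h _).1 (hA f hf g hg) a b hab
    rw [Set.piecewise_eq_of_mem _ _ _ ha, Set.piecewise_eq_of_notMem _ _ _ hb] at this
    tauto
  have hsub : ((coversContaining G ∅).filter fun C => coverAssignment C ∈ D.wireRectangle V p) ⊆
      coversContaining G T := by
    intro C hC
    rw [Finset.mem_filter, mem_coversContaining] at hC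
    rw [mem_coversContaining]
    refine ⟨hC.1.1, fun v hv => ?_⟩
    rw [← coverAssignment_coe]
    exact (Finset.mem_filter.1 hv).2 _ hC.2
  have hcount := card_coversContaining_le (G := G) (d := d)
    (fun t => hexp.2.2.1 ▸ G.degree_le_maxDegree t) T
  have hcount' : (2 ^ d + 1 : ℝ) ^ T.card * (coversContaining G T).card ≤
      (2 ^ d) ^ T.card * (coversContaining G ∅).card := by exact_mod_cast hcount
  have h1 : (1 : ℝ) ≤ (2 ^ d + 1) / 2 ^ d := by
    rw [one_le_div (by positivity)]; linarith
  calc _ ≤ ((coversContaining G T).card : ℝ) * ((2 ^ d + 1) / 2 ^ d : ℝ) ^ (T.card : ℝ) := by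
        refine mul_le_mul (by exact_mod_cast Finset.card_le_card hsub)
          (Real.rpow_le_rpow_of_exponent_le h1 ?_) (by positivity) (by positivity)
        rw [div_le_iff₀ (by positivity)]
        linarith
    _ ≤ _ := by
        rw [Real.rpow_natCast, div_pow, ← mul_div_assoc, div_le_iff₀ (by positivity)]
        linarith

/-- A decomposable circuit for the vertex covers of an expander has exponentially many wires. -/
theorem Computes.size_ge {D : NNF X} (hD : D.IsDNNF) {G : SimpleGraph V}
    (h : D.Computes G) (hV : 2 ≤ V.card) (hG : ∀ v, ∃ w, G.Adj v w) {e : ℝ} {d : ℕ}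
    (hexp : IsExpander G e d) :
    ((2 ^ d + 1) / 2 ^ d : ℝ) ^ (e * V.card / (3 * (d + 1))) ≤ D.size := by
  classical
  have := D.finite_gate
  have := Fintype.ofFinite D.Gate
  set r := ((2 ^ d + 1) / 2 ^ d : ℝ) ^ (e * V.card / (3 * (d + 1))) with hr
  have hrpos : 0 ≤ r := by positivity
  let Ws : Finset (D.Gate × D.Gate) := Finset.univ.filter fun p => D.Wire p.1 p.2
  have hWs : D.size = Ws.card := by
    rw [size, ← Set.ncard_coe_finset]
    congr 1
    ext p
    simp [Ws]
  have hpos : 0 < (coversContaining G ∅).card :=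
    Finset.card_pos.2 ⟨Finset.univ, mem_coversContaining.2 ⟨by simp, by simp⟩⟩
  have hsub : coversContaining G ∅ ⊆ Ws.biUnion fun p =>
      (coversContaining G ∅).filter fun C => coverAssignment C ∈ D.wireRectangle V p := by
    intro C hC
    obtain ⟨p, hp, hCp⟩ := (exists_rectangle_cover hD hV (h.vertices_subset hG)).1
      (coverAssignment C) ((h _).2 fun v w hvw => by
        rw [coverAssignment_coe, coverAssignment_coe]
        exact (mem_coversContaining.1 hC).1 v w hvw)
    exact Finset.mem_biUnion.2 ⟨p, by simpa [Ws] using hp, Finset.mem_filter.2 ⟨hC, hCp⟩⟩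
  have hle : ((coversContaining G ∅).card : ℝ) ≤ ∑ p ∈ Ws,
      (((coversContaining G ∅).filter
        fun C => coverAssignment C ∈ D.wireRectangle V p).card : ℝ) := by
    exact_mod_cast (Finset.card_le_card hsub).trans Finset.card_biUnion_le
  have hsum : ((coversContaining G ∅).card : ℝ) * r ≤
      (coversContaining G ∅).card * D.size := by
    calc _ ≤ _ := mul_le_mul_of_nonneg_right hle hrpos
      _ = _ := Finset.sum_mul _ _ _
      _ ≤ ∑ p ∈ Ws, ((coversContaining G ∅).card : ℝ) :=
          Finset.sum_le_sum fun p _ => h.rectangle_card_le hD hV hG hexp p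
      _ = _ := by rw [Finset.sum_const, hWs, nsmul_eq_mul, mul_comm]
  exact le_of_mul_le_mul_left hsum (by exact_mod_cast hpos)

end NNF

/-! ### Graph CNFs: syntactic properties, size, and DNNF size -/

section GraphCNF

variable {X : Type} {V : Finset X} (G : SimpleGraph V) (hV : 2 ≤ V.card)
  (hG : ∀ v, ∃ w, G.Adj v w)

theorem graphCNF_computes : (graphCNF G hV hG).Computes G := by
  intro f
  constructor
  · intro h v w hvw
    -- The gate is generalised to a variable with an equation so that case analysis on `Holds`
    -- applies.
    have h1 : ∀ g, (graphCNF G hV hG).Holds f g → g = .inr (.inr ()) →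
        (graphCNF G hV hG).Holds f (.inr (.inl ⟨s(v, w), hvw⟩)) := by
      rintro g (⟨_, h⟩ | ⟨_, x, b, h⟩ | ⟨_, h, hv⟩ | ⟨_, u, h⟩) rfl
      · cases h
      · cases h
      · exact hv _ trivial
      · cases h
    have h2 : ∀ g, (graphCNF G hV hG).Holds f g → g = .inr (.inl ⟨s(v, w), hvw⟩) →
        (graphCNF G hV hG).Holds f (.inl v) ∨ (graphCNF G hV hG).Holds f (.inl w) := by
      rintro g (⟨_, h⟩ | ⟨_, x, b, h⟩ | ⟨_, h⟩ | ⟨_, u, h, hw, hu⟩) rfl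
      · cases h
      · cases h
      · cases h
      · rcases u with u | u | u
        · rcases Sym2.mem_iff.1 hw with rfl | rfl
          · exact .inl hu
          · exact .inr hu
        · exact hw.elim
        · exact hw.elim
    have h3 : ∀ v g, (graphCNF G hV hG).Holds f g → g = .inl v → f v = true := by
      rintro v g (⟨_, h⟩ | ⟨_, x, b, h, hx⟩ | ⟨_, h⟩ | ⟨_, u, h⟩) rfl
      · cases h
      · cases h; exact hx
      · cases h
      · cases h
    exact (h2 _ (h1 _ h rfl) rfl).imp (fun h => h3 v _ h rfl) fun h => h3 w _ h rfl
  · intro h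
    refine .and _ rfl ?_
    rintro (u | ⟨e, he⟩ | u) hu
    · exact hu.elim
    · induction e with
      | h v w =>
        rcases h v w he with hv | hw
        · exact .or _ (.inl v) rfl (Sym2.mem_mk_left v w) (.lit _ v true rfl hv)
        · exact .or _ (.inl w) rfl (Sym2.mem_mk_right v w) (.lit _ w true rfl hw)
    · exact hu.elim

theorem graphCNF_isMonotone : (graphCNF G hV hG).IsMonotone := by
  rintro (v | e | u) x h <;> cases h

theorem graphCNF_rank_of_hasPath (n : ℕ) (u v : GraphGate G)
    (h : (graphCNF G hV hG).HasPath n u v) : graphRank G u + n ≤ graphRank G v := by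
  induction n generalizing u with
  | zero => cases h; exact le_rfl
  | succ n ih =>
    obtain ⟨w, hw, hp⟩ := h
    have := ih w hp
    have := graphRank_lt G u w hw
    omega

theorem graphCNF_isCNF : (graphCNF G hV hG).IsCNF := by
  refine ⟨⟨?_, ?_⟩, ?_⟩
  · obtain ⟨x, hx⟩ := Finset.card_pos.mp (lt_of_lt_of_le two_pos hV)
    obtain ⟨w, hw⟩ := hG ⟨x, hx⟩
    exact ⟨.inl ⟨x, hx⟩, trivial, .inr (.inl ⟨s(⟨x, hx⟩, w), hw⟩), Sym2.mem_mk_left _ w,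
      .inr (.inr ()), trivial, rfl⟩
  · rintro n ⟨u, -, hp⟩
    have := graphCNF_rank_of_hasPath G hV hG n u _ hp
    have : graphRank G (graphCNF G hV hG).output = 2 := rfl
    omega
  · rintro (u | u | u) (v | v | v) hl hw
    any_goals first | exact hw.elim | skip
    · trivial
    · cases hl

theorem graphCNF_isKCNF : (graphCNF G hV hG).IsKCNF 2 := by
  classical
  refine ⟨graphCNF_isCNF G hV hG, ?_⟩
  rintro (v | ⟨e, he⟩ | v) hl
  · cases hl
  · induction e with
    | h v w =>
      have hsub : {u | (graphCNF G hV hG).Wire u (.inr (.inl ⟨s(v, w), he⟩))} ⊆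
          ({.inl v, .inl w} : Set (GraphGate G)) := by
        rintro (u | u | u) hu
        · exact (Sym2.mem_iff.1 hu).imp (congrArg _) (congrArg _)
        · exact hu.elim
        · exact hu.elim
      exact (Set.ncard_le_ncard hsub ((Set.finite_singleton _).insert _)).trans
        ((Set.ncard_insert_le _ _).trans (Nat.succ_le_succ (Set.ncard_singleton _).le))
  · cases hl

theorem ncard_le_of_subset_range {α β : Type} [Fintype α] (f : α → β) {s : Set β}
    (h : s ⊆ Set.range f) : s.ncard ≤ Fintype.card α := by
  rw [← Set.image_univ] at h
  refine (Set.ncard_le_ncard h (Set.toFinite _)).trans ((Set.ncard_image_le).trans ?_)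
  rw [Set.ncard_univ, Nat.card_eq_fintype_card]

theorem graphCNF_isReadTimes {d : ℕ} (hd : ∀ v, (G.neighborSet v).ncard ≤ d) :
    (graphCNF G hV hG).IsReadTimes d := by
  classical
  refine ⟨graphCNF_isCNF G hV hG, ?_⟩
  rintro x ⟨u, b, hu⟩
  obtain ⟨v, rfl⟩ : ∃ v : V, (v : X) = x := by
    rcases u with u | u | u
    · cases hu; exact ⟨u, rfl⟩
    · cases hu
    · cases hu
  refine (ncard_le_of_subset_range (α := G.neighborSet v) (fun w =>
    ((.inl v, .inr (.inl ⟨s(v, w), w.2⟩)) : GraphGate G × GraphGate G)) ?_).trans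
    (le_of_eq_of_le ?_ (hd v))
  · rintro ⟨a | a | a, c | c | c⟩ ⟨hw, b', hb⟩
    any_goals first | exact hw.elim | skip
    · obtain ⟨e, he⟩ := c
      have hav : a = v := Subtype.ext (GateLabel.lit.inj hb).1
      subst hav
      obtain ⟨w, rfl⟩ := Sym2.mem_iff_exists.1 hw
      exact ⟨⟨w, he⟩, rfl⟩
    · cases hb
  · rw [← Nat.card_eq_fintype_card, Nat.card_coe_set_eq]

/-- Two copies of the darts cover the wires: a dart names the wire from its first vertex to its
edge, and also the wire from that edge to the output, the latter being named twice. -/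
theorem graphCNF_size_le {d : ℕ} (hd : ∀ v, (G.neighborSet v).ncard ≤ d) :
    (graphCNF G hV hG).size ≤ 2 * d * V.card := by
  classical
  have hcard : Fintype.card G.Dart ≤ V.card * d := by
    rw [SimpleGraph.dart_card_eq_sum_degrees, ← Fintype.card_coe V, ← Finset.card_univ]
    refine Finset.sum_le_card_nsmul _ _ _ fun v _ => le_of_eq_of_le ?_ (hd v)
    rw [← SimpleGraph.card_neighborSet_eq_degree, ← Nat.card_eq_fintype_card,
      Nat.card_coe_set_eq]
  refine (ncard_le_of_subset_range (α := G.Dart ⊕ G.Dart) (Sum.elim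
    (fun a => ((.inl a.fst, .inr (.inl ⟨a.edge, a.edge_mem⟩)) : GraphGate G × GraphGate G))
    (fun a => (.inr (.inl ⟨a.edge, a.edge_mem⟩), .inr (.inr ())))) ?_).trans ?_
  · rintro ⟨a | a | a, c | c | c⟩ hw
    any_goals first | exact hw.elim | skip
    · obtain ⟨e, he⟩ := c
      obtain ⟨w, rfl⟩ := Sym2.mem_iff_exists.1 hw
      exact ⟨.inl ⟨(a, w), he⟩, rfl⟩
    · obtain ⟨e, he⟩ := a
      induction e with
      | h v w => exact ⟨.inr ⟨(v, w), he⟩, rfl⟩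
  · rw [Fintype.card_sum]
    linarith

/-- The gates of the disjunction, over all vertex covers, of the conjunction of the cover. -/
abbrev CoverGate (G : SimpleGraph V) : Type :=
  V ⊕ {C : Finset V // C ∈ coversContaining G ∅} ⊕ Unit

def coverWire : CoverGate G → CoverGate G → Prop
  | .inl v, .inr (.inl C) => v ∈ C.1
  | .inr (.inl _), .inr (.inr _) => True
  | _, _ => False

def coverLabel : CoverGate G → GateLabel X
  | .inl v => .lit v.1 true
  | .inr (.inl _) => .and
  | .inr (.inr _) => .or

def coverRank : CoverGate G → ℕ
  | .inl _ => 0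
  | .inr (.inl _) => 1
  | .inr (.inr _) => 2

theorem coverRank_lt (u v : CoverGate G) (h : coverWire G u v) :
    coverRank G u < coverRank G v := by
  rcases u with u | u | u <;> rcases v with v | v | v <;> simp_all [coverWire, coverRank]

theorem univ_mem_coversContaining : Finset.univ ∈ coversContaining G ∅ :=
  mem_coversContaining.2 ⟨by simp, by simp⟩

theorem exists_mem_of_mem_coversContaining (hV : 2 ≤ V.card) (hG : ∀ v, ∃ w, G.Adj v w)
    {C : Finset V} (hC : C ∈ coversContaining G ∅) :
    ∃ v, v ∈ C := by
  obtain ⟨x, hx⟩ := Finset.card_pos.mp (lt_of_lt_of_le two_pos hV)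
  obtain ⟨w, hw⟩ := hG ⟨x, hx⟩
  rcases (mem_coversContaining.1 hC).1 _ _ hw with h | h
  exacts [⟨_, h⟩, ⟨_, h⟩]

/-- The disjunction over all vertex covers of the conjunction of the vertices in the cover. -/
def coverDNF (hV : 2 ≤ V.card) (hG : ∀ v, ∃ w, G.Adj v w) : NNF X where
  Gate := CoverGate G
  finite_gate := inferInstance
  Wire := coverWire G
  label := coverLabel G
  output := .inr (.inr ())
  acyclic := by
    have key : ∀ u v, Relation.TransGen (coverWire G) u v → coverRank G u < coverRank G v := by
      intro u v h
      induction h with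
      | single h => exact coverRank_lt G _ _ h
      | tail _ h ih => exact ih.trans (coverRank_lt G _ _ h)
    exact fun v h => lt_irrefl _ (key v v h)
  sink_iff := by
    rintro (v | C | u)
    · simp only [reduceCtorEq, iff_false, not_forall, not_not]
      exact ⟨.inr (.inl ⟨_, univ_mem_coversContaining G⟩), Finset.mem_univ v⟩
    · simp only [Sum.inr.injEq, reduceCtorEq, iff_false, not_forall, not_not]
      exact ⟨.inr (.inr ()), trivial⟩
    · simp only [iff_true]
      rintro (w | w | w) h <;> exact h
  source_iff := by
    rintro (v | ⟨C, hC⟩ | u)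
    · simp only [coverLabel, GateLabel.IsInput, iff_true]
      rintro (w | w | w) h <;> exact h
    · simp only [coverLabel, GateLabel.IsInput, iff_false, not_forall, not_not]
      obtain ⟨v, hv⟩ := exists_mem_of_mem_coversContaining G hV hG hC
      exact ⟨.inl v, hv⟩
    · simp only [coverLabel, GateLabel.IsInput, iff_false, not_forall, not_not]
      exact ⟨.inr (.inl ⟨_, univ_mem_coversContaining G⟩), trivial⟩

theorem coverDNF_isDNNF : (coverDNF G hV hG).IsDNNF := by
  rintro (v | C | v) hl u w hu hw huw
  · cases hl
  · rcases u with u | u | u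
    · rcases w with w | w | w
      · rw [Set.disjoint_left]
        intro x hx hx'
        obtain ⟨b, hb⟩ := NNF.eq_of_mem_varsAt_input (C := coverDNF G hV hG) (v := .inl u)
          trivial hx
        obtain ⟨c, hc⟩ := NNF.eq_of_mem_varsAt_input (C := coverDNF G hV hG) (v := .inl w)
          trivial hx'
        exact huw (congrArg _ (Subtype.ext
          ((GateLabel.lit.inj hb).1.trans (GateLabel.lit.inj hc).1.symm)))
      · exact hw.elim
      · exact hw.elim
    · exact hu.elim
    · exact hu.elim
  · cases hl

theorem coverDNF_computes : (coverDNF G hV hG).Computes G := by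
  classical
  intro f
  constructor
  · intro h v w hvw
    have h1 : ∀ g, (coverDNF G hV hG).Holds f g → g = .inr (.inr ()) →
        ∃ C, (coverDNF G hV hG).Holds f (.inr (.inl C)) := by
      rintro g (⟨_, h⟩ | ⟨_, x, b, h⟩ | ⟨_, h⟩ | ⟨_, u, h, hw, hu⟩) rfl
      · cases h
      · cases h
      · cases h
      · rcases u with u | u | u
        · exact hw.elim
        · exact ⟨u, hu⟩
        · exact hw.elim
    have h2 : ∀ C g, (coverDNF G hV hG).Holds f g → g = .inr (.inl C) →
        ∀ v ∈ C.1, (coverDNF G hV hG).Holds f (.inl v) := by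
      rintro C g (⟨_, h⟩ | ⟨_, x, b, h⟩ | ⟨_, h, hv⟩ | ⟨_, u, h⟩) rfl v hvC
      · cases h
      · cases h
      · exact hv _ hvC
      · cases h
    have h3 : ∀ v g, (coverDNF G hV hG).Holds f g → g = .inl v → f v = true := by
      rintro v g (⟨_, h⟩ | ⟨_, x, b, h, hx⟩ | ⟨_, h⟩ | ⟨_, u, h⟩) rfl
      · cases h
      · cases h; exact hx
      · cases h
      · cases h
    obtain ⟨C, hC⟩ := h1 _ h rfl
    exact ((mem_coversContaining.1 C.2).1 v w hvw).imp
      (fun h => h3 v _ (h2 C _ hC rfl v h) rfl) (fun h => h3 w _ (h2 C _ hC rfl w h) rfl)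
  · intro h
    refine .or _ (.inr (.inl ⟨Finset.univ.filter fun v : V => f v = true,
      mem_coversContaining.2 ⟨fun v w hvw => ?_, by simp⟩⟩)) rfl trivial (.and _ rfl ?_)
    · simpa using h v w hvw
    · rintro (v | v | v) hv
      · exact .lit _ v true rfl (Finset.mem_filter.1 hv).2
      · exact hv.elim
      · exact hv.elim

theorem graphCNF_dnnfSize_ge {e : ℝ} {d : ℕ} (hexp : IsExpander G e d) :
    ((2 ^ d + 1) / 2 ^ d : ℝ) ^ (e * V.card / (3 * (d + 1))) ≤
      (graphCNF G hV hG).dnnfSize := by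
  -- The infimum of an empty set would be 0. `coverDNF` shows that some equivalent DNNF exists, so
  -- the infimum is attained.
  obtain ⟨D, hD, heq, hsize⟩ := Nat.sInf_mem (s := {n | ∃ D : NNF X, D.IsDNNF ∧
    D.Equivalent (graphCNF G hV hG) ∧ D.size = n})
    ⟨_, coverDNF G hV hG, coverDNF_isDNNF G hV hG, fun f =>
      (coverDNF_computes G hV hG f).trans (graphCNF_computes G hV hG f).symm, rfl⟩
  rw [NNF.dnnfSize, ← hsize]
  exact NNF.Computes.size_ge hD (fun f => (heq f).trans (graphCNF_computes G hV hG f)) hV hG hexp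

end GraphCNF

/-! ### Permutations mapping one set into another -/

section PermCounting

open Equiv in
theorem exists_perm_mem_iff {α : Type} [Fintype α] [DecidableEq α] {P Q : Finset α}
    (h : P.card = Q.card) : ∃ σ : Perm α, ∀ a, σ a ∈ Q ↔ a ∈ P := by
  let e : {x // x ∈ P} ≃ {x // x ∈ Q} := Finset.equivOfCardEq h
  refine ⟨e.extendSubtype, fun a => ⟨fun ha => ?_, fun ha => e.extendSubtype_mem a ha⟩⟩
  by_contra hn
  exact e.extendSubtype_not_mem a hn ha

open Equiv Nat in
/-- The number of permutations mapping `P` into `R`. -/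
theorem card_perm_mapsTo {α : Type} [Fintype α] [DecidableEq α] (P R : Finset α) :
    (Fintype.card α).choose P.card *
        (Finset.univ.filter fun π : Perm α => ∀ a ∈ P, π a ∈ R).card =
      (Fintype.card α)! * R.card.choose P.card := by
  -- Double counting of pairs `(Q, π)` where `Q` has the size of `P` and `π` maps it into `R`. The
  -- number of `π` is the same for every such `Q`, by composing with a permutation that carries `P`
  -- to `Q`.
  have key := Finset.sum_card_bipartiteAbove_eq_sum_card_bipartiteBelow
    (s := Finset.powersetCard P.card (Finset.univ : Finset α))
    (t := (Finset.univ : Finset (Perm α))) (fun Q π => ∀ a ∈ Q, π a ∈ R)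
  rw [Finset.sum_congr rfl
      (g := fun _ => (Finset.univ.filter fun π : Perm α => ∀ a ∈ P, π a ∈ R).card),
    Finset.sum_congr (s₁ := Finset.univ) rfl (g := fun _ => R.card.choose P.card)] at key
  · simpa [Fintype.card_perm] using key
  · intro π _
    rw [← Finset.card_map π.symm.toEmbedding (s := R), ← Finset.card_powersetCard]
    congr 1
    ext Q
    simp only [Finset.bipartiteBelow, Finset.mem_filter, Finset.mem_powersetCard,
      Finset.subset_univ, true_and]
    rw [and_comm]
    refine and_congr_left fun _ => ⟨?_, ?_⟩
    · exact fun h a ha => Finset.mem_map.2 ⟨π a, h a ha, by simp⟩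
    · intro h a ha
      obtain ⟨b, hb, rfl⟩ := Finset.mem_map.1 (h ha)
      simpa using hb
  · intro Q hQ
    obtain ⟨σ, hσ⟩ := exists_perm_mem_iff (Finset.mem_powersetCard.1 hQ).2.symm
    refine Finset.card_bijective (Equiv.mulRight σ) (Equiv.bijective _) fun π => ?_
    simp only [Finset.bipartiteAbove, Finset.mem_filter, Finset.mem_univ, true_and,
      Equiv.coe_mulRight, Perm.mul_apply]
    constructor
    · exact fun h a ha => h _ ((hσ a).2 ha)
    · intro h a ha
      have := h (σ.symm a) ((hσ _).1 (by simpa using ha))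
      simpa using this

end PermCounting

/-! ### Subsets of a cycle with few starts and stops -/

section CyclicBoundary

variable {n : ℕ} [NeZero n]

/-- The positions at which a subset of a cycle starts or stops. -/
def cyclicBoundary (P : Finset (ZMod n)) : Finset (ZMod n) :=
  Finset.univ.filter fun i => ¬ (i ∈ P ↔ i + 1 ∈ P)

theorem mem_cyclicBoundary {P : Finset (ZMod n)} {i : ZMod n} :
    i ∈ cyclicBoundary P ↔ ¬ (i ∈ P ↔ i + 1 ∈ P) := by
  simp [cyclicBoundary]

theorem eq_of_cyclicBoundary_eq {P Q : Finset (ZMod n)} (h : cyclicBoundary P = cyclicBoundary Q)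
    (h0 : 0 ∈ P ↔ 0 ∈ Q) : P = Q := by
  have key : ∀ k : ℕ, (k : ZMod n) ∈ P ↔ (k : ZMod n) ∈ Q := by
    intro k
    induction k with
    | zero => simpa using h0
    | succ k ih =>
      have := Finset.ext_iff.1 h (k : ZMod n)
      rw [mem_cyclicBoundary, mem_cyclicBoundary] at this
      push_cast
      tauto
  ext i
  rw [← ZMod.natCast_zmod_val i]
  exact key _

/-- A set is determined by its boundary and by whether it contains 0, whence the factor 2. In the
expansion of `(1 + x) ^ n` over subsets, each one of size at most `j` contributes at least `x ^ j`.
-/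
theorem card_filter_cyclicBoundary_le (j : ℕ) {x : ℝ} (hx : 0 < x) (hx1 : x ≤ 1) :
    ((Finset.univ.filter fun P : Finset (ZMod n) => (cyclicBoundary P).card ≤ j).card : ℝ) * x ^ j
      ≤ 2 * (1 + x) ^ n := by
  have h1 : (Finset.univ.filter fun P : Finset (ZMod n) => (cyclicBoundary P).card ≤ j).card ≤
      ((Finset.univ.filter fun s : Finset (ZMod n) => s.card ≤ j) ×ˢ
        (Finset.univ : Finset Bool)).card := by
    refine Finset.card_le_card_of_injOn (fun P => (cyclicBoundary P, decide (0 ∈ P))) ?_ ?_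
    · intro P hP
      simpa [em] using hP
    · intro P _ Q _ h
      simp only [Prod.mk.injEq, decide_eq_decide] at h
      exact eq_of_cyclicBoundary_eq h.1 h.2
  rw [Finset.card_product, Finset.card_univ, Fintype.card_bool] at h1
  have h2 : ((Finset.univ.filter fun s : Finset (ZMod n) => s.card ≤ j).card : ℝ) * x ^ j ≤
      (1 + x) ^ n := by
    have := Fintype.sum_pow_mul_eq_add_pow (ZMod n) x 1
    rw [ZMod.card, add_comm x] at this
    rw [← this, ← nsmul_eq_mul]
    refine (Finset.card_nsmul_le_sum _ (fun s => x ^ s.card * 1 ^ (n - s.card)) _ ?_).trans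
      (Finset.sum_le_sum_of_subset_of_nonneg (Finset.filter_subset _ _)
        fun s _ _ => by positivity)
    intro s hs
    rw [one_pow, mul_one]
    exact pow_le_pow_of_le_one hx.le hx1 (Finset.mem_filter.1 hs).2
  have h1' : ((Finset.univ.filter fun P : Finset (ZMod n) =>
      (cyclicBoundary P).card ≤ j).card : ℝ) ≤
      ((Finset.univ.filter fun s : Finset (ZMod n) => s.card ≤ j).card : ℝ) * 2 := by
    exact_mod_cast h1
  nlinarith [pow_pos hx j]

end CyclicBoundary

/-! ### Numerical estimates for the union bound -/

section Estimates

theorem pow_le_choose_mul_pow {n p : ℕ} (h : p ≤ n) : n ^ p ≤ n.choose p * p ^ p := by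
  induction p generalizing n with
  | zero => simp
  | succ p ih =>
    obtain ⟨n, rfl⟩ : ∃ m, n = m + 1 := ⟨n - 1, by omega⟩
    rcases Nat.eq_zero_or_pos p with rfl | hp
    · simp
    have h1 := ih (Nat.le_of_succ_le_succ h)
    have h2 : ((n + 1) * p) ^ p ≤ (n * (p + 1)) ^ p := Nat.pow_le_pow_left (by nlinarith) _
    rw [mul_pow, mul_pow] at h2
    have h3 := Nat.add_one_mul_choose_eq n p
    refine Nat.le_of_mul_le_mul_right ?_ (pow_pos hp p)
    calc (n + 1) ^ (p + 1) * p ^ p = (n + 1) * ((n + 1) ^ p * p ^ p) := by ring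
      _ ≤ (n + 1) * (n ^ p * (p + 1) ^ p) := Nat.mul_le_mul_left _ h2
      _ ≤ (n + 1) * (n.choose p * p ^ p * (p + 1) ^ p) := by gcongr
      _ = ((n + 1) * n.choose p) * (p ^ p * (p + 1) ^ p) := by ring
      _ = _ := by rw [h3]; ring

theorem choose_mul_pow_le (a k : ℕ) {y : ℝ} (hy : 0 ≤ y) :
    (a.choose k : ℝ) * y ^ k ≤ (1 + y) ^ a := by
  rcases lt_or_ge a k with h | h
  · rw [Nat.choose_eq_zero_of_lt h]
    simp only [Nat.cast_zero, zero_mul]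
    positivity
  · rw [add_comm, add_pow]
    refine le_trans (le_of_eq ?_) (Finset.single_le_sum
      (f := fun m => y ^ m * 1 ^ (a - m) * (a.choose m : ℝ)) (fun i _ => by positivity)
      (Finset.mem_range.2 (Nat.lt_succ_of_le h)))
    rw [one_pow, mul_one, mul_comm]

/-- Put `l = 7 / 6 * u`, where `7 / 6 * (9 / 10) = 21 / 20`. It remains to bound the first power by
`u ^ p`; this follows from `100 * l ≤ u ^ 20`, as the exponent is at most `p / 20`. -/
theorem rate_pow_le {l : ℝ} (hl : 199 / 100 ≤ l) (p : ℕ) :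
    (100 * l) ^ (5 * (p / 100)) * (21 / 20) ^ p ≤ (9 / 10) ^ p * l ^ p := by
  obtain ⟨u, rfl⟩ : ∃ u, l = 7 / 6 * u := ⟨6 / 7 * l, by ring⟩
  have hu : (17 / 10 : ℝ) ≤ u := by linarith
  have hu1 : (1 : ℝ) ≤ u := by linarith
  have h1 : 100 * (7 / 6 * u) ≤ u ^ 20 := by
    have : (17 / 10 : ℝ) ^ 19 ≤ u ^ 19 := pow_le_pow_left₀ (by norm_num) hu 19
    have : (350 / 3 : ℝ) ≤ u ^ 19 := le_trans (by norm_num) this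
    rw [pow_succ]
    nlinarith
  have h2 : (100 * (7 / 6 * u)) ^ (5 * (p / 100)) ≤ u ^ p := by
    calc _ ≤ (u ^ 20) ^ (5 * (p / 100)) := pow_le_pow_left₀ (by positivity) h1 _
      _ = u ^ (100 * (p / 100)) := by rw [← pow_mul]; congr 1; ring
      _ ≤ u ^ p := pow_le_pow_right₀ hu1 (Nat.mul_div_le p 100)
  calc _ ≤ u ^ p * (21 / 20) ^ p := mul_le_mul_of_nonneg_right h2 (by positivity)
    _ = _ := by rw [← mul_pow, ← mul_pow]; congr 1; ring

/-- Here `N` bounds the choices for each of two sets with few starts and stops, and the quotient of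
the binomials bounds the probability that a random permutation maps one into the other. The product
decays geometrically in `p`. -/
theorem sq_mul_choose_le {n p N : ℕ} (hp : 0 < p) (h : 199 * p ≤ 100 * n)
    (hN : ∀ x : ℝ, 0 < x → x ≤ 1 → (N : ℝ) * x ^ (2 * (p / 100)) ≤ 2 * (1 + x) ^ n) :
    (N : ℝ) ^ 2 * ((p + p / 100).choose p : ℝ) ≤ 4 * (9 / 10) ^ p * (n.choose p : ℝ) := by
  have hpn : p ≤ n := by omega
  have hp' : (0 : ℝ) < p := by exact_mod_cast hp
  have hn' : (0 : ℝ) < n := by exact_mod_cast lt_of_lt_of_le hp hpn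
  set k := p / 100 with hk
  set l : ℝ := n / p with hl
  have hl199 : 199 / 100 ≤ l := by
    rw [hl, div_le_div_iff₀ (by norm_num) hp']
    have : (199 * p : ℝ) ≤ 100 * n := by exact_mod_cast h
    linarith
  have hlpos : 0 < l := by linarith
  have hexp : Real.exp (1 / 50) * (101 / 100) ≤ 21 / 20 := by
    have h1 := Real.add_one_le_exp (-(1 / 50 : ℝ))
    have h2 : Real.exp (1 / 50) * Real.exp (-(1 / 50)) = 1 := by
      rw [← Real.exp_add, add_neg_cancel, Real.exp_zero]
    nlinarith [Real.exp_pos (1 / 50 : ℝ)]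
  have hC : ((p + k).choose p : ℝ) ≤ (100 * l) ^ k * (101 / 100) ^ p := by
    have h1 := choose_mul_pow_le (p + k) k (y := 1 / 100) (by norm_num)
    rw [Nat.choose_symm_add]
    have h2 : ((p + k).choose k : ℝ) ≤ 101 ^ k * (101 / 100) ^ p := by
      have h3 : (1 / 100 : ℝ) ^ k * 100 ^ k = 1 := by rw [← mul_pow]; norm_num
      calc ((p + k).choose k : ℝ) = ((p + k).choose k * (1 / 100 : ℝ) ^ k) * 100 ^ k := by
            rw [mul_assoc, h3, mul_one]
        _ ≤ (1 + 1 / 100 : ℝ) ^ (p + k) * 100 ^ k := by gcongr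
        _ = _ := by
            rw [pow_add, mul_assoc, ← mul_pow, mul_comm]
            norm_num
    refine h2.trans ?_
    gcongr
    linarith
  have hNN : (N : ℝ) ^ 2 ≤ 4 * (100 * l) ^ (4 * k) * Real.exp (1 / 50) ^ p := by
    -- With this `x`, `n * x = p / 100`, so `(1 + x) ^ n` costs only `exp (p / 100)`.
    have h1 := hN (1 / (100 * l)) (by positivity) (by
      rw [div_le_one (by positivity)]; linarith)
    have h2 : (1 + 1 / (100 * l)) ^ n ≤ Real.exp (1 / 100) ^ p := by
      calc _ ≤ Real.exp (1 / (100 * l)) ^ n := by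
            gcongr
            rw [add_comm]
            exact Real.add_one_le_exp _
        _ = _ := by
            rw [← Real.exp_nat_mul, ← Real.exp_nat_mul, hl]
            congr 1
            field_simp
    have h3 : (N : ℝ) ≤ 2 * Real.exp (1 / 100) ^ p * (100 * l) ^ (2 * k) := by
      rw [one_div, inv_pow, ← div_eq_mul_inv, div_le_iff₀ (by positivity)] at h1
      refine h1.trans ?_
      gcongr
      rwa [one_div] at h2
    calc (N : ℝ) ^ 2 ≤ (2 * Real.exp (1 / 100) ^ p * (100 * l) ^ (2 * k)) ^ 2 := by gcongr
      _ = 4 * (100 * l) ^ (4 * k) * (Real.exp (1 / 100) ^ 2) ^ p := by ring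
      _ = _ := by rw [← Real.exp_nat_mul]; norm_num
  have hchoose : l ^ p ≤ n.choose p := by
    rw [hl, div_pow, div_le_iff₀ (by positivity)]
    exact_mod_cast pow_le_choose_mul_pow hpn
  calc _ ≤ (4 * (100 * l) ^ (4 * k) * Real.exp (1 / 50) ^ p) *
        ((100 * l) ^ k * (101 / 100) ^ p) := by gcongr
    _ = 4 * ((100 * l) ^ (5 * k) * (Real.exp (1 / 50) * (101 / 100)) ^ p) := by ring
    _ ≤ 4 * ((100 * l) ^ (5 * k) * (21 / 20) ^ p) := by gcongr
    _ ≤ 4 * ((9 / 10) ^ p * l ^ p) := mul_le_mul_of_nonneg_left (rate_pow_le hl199 p) (by norm_num)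
    _ ≤ _ := by rw [← mul_assoc]; gcongr

end Estimates

/-! ### Expansion of two cycles joined by a random matching -/

section Prism

variable {n : ℕ}

/-- The adjacency relation of two cycles joined by the perfect matching `π`. -/
def prismAdj (π : Equiv.Perm (ZMod n)) : ZMod n ⊕ ZMod n → ZMod n ⊕ ZMod n → Prop
  | .inl a, .inl b => b = a + 1 ∨ a = b + 1
  | .inr a, .inr b => b = a + 1 ∨ a = b + 1
  | .inl a, .inr b => b = π a
  | .inr b, .inl a => b = π a

/-- Two cycles joined by the perfect matching `π`. -/
def prism (hn : 2 ≤ n) (π : Equiv.Perm (ZMod n)) : SimpleGraph (ZMod n ⊕ ZMod n) where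
  Adj := prismAdj π
  symm := ⟨by
    rintro (a | a) (b | b) h
    · exact Or.symm h
    · exact h
    · exact h
    · exact Or.symm h⟩
  loopless := ⟨by
    have : Fact (1 < n) := ⟨hn⟩
    rintro (a | a) h <;> rcases h with h | h <;> simp at h⟩

theorem ncard_neighborSet_prism (hn : 3 ≤ n) (π : Equiv.Perm (ZMod n))
    (v : ZMod n ⊕ ZMod n) : ((prism (by omega) π).neighborSet v).ncard = 3 := by
  have hne : ∀ a : ZMod n, a + 1 ≠ a - 1 := by
    intro a h
    have h2 : ((2 : ℕ) : ZMod n) = 0 := by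
      push_cast
      linear_combination h
    rw [ZMod.natCast_eq_zero_iff] at h2
    have := Nat.le_of_dvd (by norm_num) h2
    omega
  rcases v with a | a
  · have : (prism (by omega) π).neighborSet (.inl a) =
        (({.inl (a + 1), .inl (a - 1), .inr (π a)} : Finset (ZMod n ⊕ ZMod n)) : Set _) := by
      ext (b | b)
      · simp [prism, prismAdj, eq_sub_iff_add_eq, eq_comm]
      · simp [prism, prismAdj]
    rw [this, Set.ncard_coe_finset, Finset.card_insert_of_notMem, Finset.card_pair] <;>
      simp [hne]
  · have : (prism (by omega) π).neighborSet (.inr a) =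
        (({.inr (a + 1), .inr (a - 1), .inl (π.symm a)} : Finset (ZMod n ⊕ ZMod n)) : Set _) := by
      ext (b | b)
      · simp [prism, prismAdj, Equiv.eq_symm_apply, eq_comm]
      · simp [prism, prismAdj, eq_sub_iff_add_eq, eq_comm]
    rw [this, Set.ncard_coe_finset, Finset.card_insert_of_notMem, Finset.card_pair] <;>
      simp [hne]

variable [NeZero n]

/-- Some set of medium size with few starts and stops is mapped by `π` into a set that is hardly
larger and has few starts and stops as well. -/
def IsCompressing (π : Equiv.Perm (ZMod n)) : Prop :=
  ∃ P R : Finset (ZMod n), 100 ≤ P.card ∧ 199 * P.card ≤ 100 * n ∧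
    (cyclicBoundary P).card ≤ 2 * (P.card / 100) ∧ (cyclicBoundary R).card ≤ 2 * (P.card / 100) ∧
    R.card ≤ P.card + P.card / 100 ∧ ∀ a ∈ P, π a ∈ R

open Classical Nat in
theorem card_perm_mapsTo_le {p : ℕ} (hp : p ≤ n) {P R : Finset (ZMod n)} (hP : P.card = p)
    (hR : R.card ≤ p + p / 100) :
    ((Finset.univ.filter fun π : Equiv.Perm (ZMod n) => ∀ a ∈ P, π a ∈ R).card : ℝ) ≤
      n ! * ((p + p / 100).choose p : ℝ) / (n.choose p : ℝ) := by
  have h := card_perm_mapsTo P R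
  rw [ZMod.card, hP] at h
  have hpos : (0 : ℝ) < n.choose p := by exact_mod_cast Nat.choose_pos hp
  rw [le_div_iff₀ hpos, mul_comm]
  have h2 : R.card.choose p ≤ (p + p / 100).choose p := Nat.choose_le_choose p hR
  have h3 := Nat.mul_le_mul_left (n !) h2
  rw [← h] at h3
  convert (by exact_mod_cast h3 :
    ((n.choose p * (Finset.univ.filter fun π : Equiv.Perm (ZMod n) => ∀ a ∈ P, π a ∈ R).card :
      ℕ) : ℝ) ≤ ((n ! * (p + p / 100).choose p : ℕ) : ℝ)) using 1
  all_goals push_cast; congr!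

open Classical Nat in
-- Union bound over the size `p` of the first set and over the pairs of sets. Since `p ≥ 100`, the
-- geometric series is tiny. A proportion below one half is what allows `π` and its inverse to be
-- handled together.
theorem card_isCompressing_lt :
    2 * (Finset.univ.filter fun π : Equiv.Perm (ZMod n) => IsCompressing π).card < n ! := by
  let I : Finset ℕ := (Finset.Ico 100 (n + 1)).filter fun p => 199 * p ≤ 100 * n
  let F : ℕ → Finset (Finset (ZMod n)) := fun p =>
    Finset.univ.filter fun P => (cyclicBoundary P).card ≤ 2 * (p / 100)
  let K : ℕ → Finset (Finset (ZMod n) × Finset (ZMod n)) := fun p =>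
    (F p ×ˢ F p).filter fun q => q.1.card = p ∧ q.2.card ≤ p + p / 100
  let E : Finset (ZMod n) × Finset (ZMod n) → Finset (Equiv.Perm (ZMod n)) := fun q =>
    Finset.univ.filter fun π => ∀ a ∈ q.1, π a ∈ q.2
  have hsub : (Finset.univ.filter fun π : Equiv.Perm (ZMod n) => IsCompressing π) ⊆
      I.biUnion fun p => (K p).biUnion E := by
    intro π hπ
    obtain ⟨P, R, h1, h2, h3, h4, h5, h6⟩ := (Finset.mem_filter.1 hπ).2
    simp only [Finset.mem_biUnion, I, K, F, E, Finset.mem_filter, Finset.mem_Ico,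
      Finset.mem_product, Finset.mem_univ, true_and]
    exact ⟨P.card, ⟨⟨h1, by omega⟩, h2⟩, (P, R), ⟨⟨h3, h4⟩, rfl, h5⟩, h6⟩
  have hle : ((Finset.univ.filter fun π : Equiv.Perm (ZMod n) => IsCompressing π).card : ℝ) ≤
      ∑ p ∈ I, ∑ q ∈ K p, ((E q).card : ℝ) := by
    have := (Finset.card_le_card hsub).trans (Finset.card_biUnion_le.trans
      (Finset.sum_le_sum fun p _ => Finset.card_biUnion_le))
    exact_mod_cast this
  have hp : ∀ p ∈ I, ∑ q ∈ K p, ((E q).card : ℝ) ≤ n ! * (4 * (9 / 10) ^ p) := by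
    intro p hp
    simp only [I, Finset.mem_filter, Finset.mem_Ico] at hp
    have hpn : p ≤ n := by omega
    have hpos : (0 : ℝ) < n.choose p := by exact_mod_cast Nat.choose_pos hpn
    have h1 := sq_mul_choose_le (n := n) (p := p) (N := (F p).card) (by omega) hp.2
      fun x hx hx1 => card_filter_cyclicBoundary_le (2 * (p / 100)) hx hx1
    have h2 : ((K p).card : ℝ) ≤ ((F p).card : ℝ) ^ 2 := by
      have := (Finset.card_filter_le (F p ×ˢ F p)
        fun q => q.1.card = p ∧ q.2.card ≤ p + p / 100)
      rw [Finset.card_product, ← sq] at this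
      exact_mod_cast this
    calc _ ≤ (K p).card • (n ! * ((p + p / 100).choose p : ℝ) / (n.choose p : ℝ)) := by
          refine Finset.sum_le_card_nsmul _ _ _ fun q hq => ?_
          obtain ⟨-, hq1, hq2⟩ := Finset.mem_filter.1 hq
          exact card_perm_mapsTo_le hpn hq1 hq2
      _ ≤ ((F p).card : ℝ) ^ 2 * (n ! * ((p + p / 100).choose p : ℝ) / (n.choose p : ℝ)) := by
          rw [nsmul_eq_mul]
          gcongr
      _ = n ! * ((((F p).card : ℝ) ^ 2 * ((p + p / 100).choose p : ℝ)) / (n.choose p : ℝ)) := by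
          ring
      _ ≤ _ := by
          gcongr
          rwa [div_le_iff₀ hpos]
  have hgeom : ∑ p ∈ I, ((9 / 10 : ℝ)) ^ p ≤ 1 / 16 := by
    calc _ ≤ ∑ p ∈ Finset.Ico 100 (n + 1), ((9 / 10 : ℝ)) ^ p :=
          Finset.sum_le_sum_of_subset_of_nonneg (Finset.filter_subset _ _)
            fun _ _ _ => by positivity
      _ ≤ (9 / 10) ^ 100 / (1 - 9 / 10) :=
          geom_sum_Ico_le_of_lt_one (by norm_num) (by norm_num)
      _ ≤ _ := by norm_num
  have hfac : (0 : ℝ) < n ! := by exact_mod_cast Nat.factorial_pos n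
  have hfinal : ((Finset.univ.filter fun π : Equiv.Perm (ZMod n) => IsCompressing π).card : ℝ) ≤
      n ! * (1 / 4) := by
    refine hle.trans ((Finset.sum_le_sum hp).trans ?_)
    rw [← Finset.mul_sum, ← Finset.mul_sum]
    gcongr
    linarith
  have : (2 * (Finset.univ.filter fun π : Equiv.Perm (ZMod n) => IsCompressing π).card : ℝ) <
      n ! := by linarith
  exact_mod_cast this

theorem exists_perm_not_isCompressing :
    ∃ π : Equiv.Perm (ZMod n), ¬ IsCompressing π ∧ ¬ IsCompressing π⁻¹ := by
  classical
  by_contra hcon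
  push Not at hcon
  let B : Finset (Equiv.Perm (ZMod n)) := Finset.univ.filter fun π => IsCompressing π
  have h1 : (Finset.univ : Finset (Equiv.Perm (ZMod n))) ⊆ B ∪ B.image (·⁻¹) := by
    intro π _
    by_cases h : IsCompressing π
    · exact Finset.mem_union_left _ (by simpa [B] using h)
    · exact Finset.mem_union_right _ (Finset.mem_image.2
        ⟨π⁻¹, by simpa [B] using hcon π h, inv_inv π⟩)
  have h2 := Finset.card_le_card h1
  rw [Finset.card_univ, Fintype.card_perm, ZMod.card] at h2
  have h3 := Finset.card_union_le B (B.image (·⁻¹))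
  have h4 : (B.image (·⁻¹)).card ≤ B.card := Finset.card_image_le
  have h5 : 2 * B.card < n.factorial := card_isCompressing_lt
  omega

theorem card_cyclicBoundary_le {P N : Finset (ZMod n)}
    (h1 : ∀ i ∈ P, i + 1 ∉ P → i + 1 ∈ N ∨ i ∈ N) (h2 : ∀ i ∉ P, i + 1 ∈ P → i ∈ N ∨ i + 1 ∈ N) :
    (cyclicBoundary P).card ≤ 2 * N.card := by
  have hsub : cyclicBoundary P ⊆ N ∪ N.image (· - 1) := by
    intro i hi
    rw [mem_cyclicBoundary] at hi
    have : i ∈ N ∨ i + 1 ∈ N := by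
      have := h1 i
      have := h2 i
      tauto
    rcases this with h | h
    · exact Finset.mem_union_left _ h
    · exact Finset.mem_union_right _ (Finset.mem_image.2 ⟨i + 1, h, by ring⟩)
  have h3 := Finset.card_le_card hsub
  have h4 := Finset.card_union_le N (N.image (· - 1))
  have h5 : (N.image (· - 1)).card ≤ N.card := Finset.card_image_le
  omega

/-- `P` and `Q` are the traces of a vertex set on the two cycles, `M` and `N` those of its
neighbourhood; the witness is `Q ∪ N`. As `M` and `N` together have at most `P.card / 100` elements
and `π` embeds `P` into `Q ∪ N`, the set `Q` is almost as large as `P`; with `P.card + Q.card ≤ n`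
this yields the constant 199. -/
theorem isCompressing_of_small_boundary {π : Equiv.Perm (ZMod n)} {P Q M N : Finset (ZMod n)}
    (hPQ : Q.card ≤ P.card) (hn : P.card + Q.card ≤ n)
    (hP1 : ∀ i ∈ P, i + 1 ∉ P → i + 1 ∈ M) (hP2 : ∀ i ∉ P, i + 1 ∈ P → i ∈ M)
    (hQ1 : ∀ i ∈ Q, i + 1 ∉ Q → i + 1 ∈ N) (hQ2 : ∀ i ∉ Q, i + 1 ∈ Q → i ∈ N)
    (hπ : ∀ i ∈ P, π i ∉ Q → π i ∈ N)
    (hMN : 200 * (M.card + N.card) < P.card + Q.card) : IsCompressing π := by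
  have hbP : (cyclicBoundary P).card ≤ 2 * M.card :=
    card_cyclicBoundary_le (fun i h h' => .inl (hP1 i h h')) fun i h h' => .inl (hP2 i h h')
  have hbR : (cyclicBoundary (Q ∪ N)).card ≤ 2 * N.card := by
    refine card_cyclicBoundary_le (fun i h h' => ?_) fun i h h' => ?_
    · rw [Finset.mem_union] at h h'
      have := hQ1 i
      tauto
    · rw [Finset.mem_union] at h h'
      have := hQ2 i
      tauto
  have hR := Finset.card_union_le Q N
  have hmaps : ∀ a ∈ P, π a ∈ Q ∪ N := fun a ha => by
    rw [Finset.mem_union]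
    have := hπ a ha
    tauto
  have hPR : P.card ≤ (Q ∪ N).card :=
    Finset.card_le_card_of_injOn π hmaps π.injective.injOn
  refine ⟨P, Q ∪ N, ?_, by omega, by omega, by omega, by omega, hmaps⟩
  -- If `P` had fewer than 100 elements, `M` would be empty and `P` would have no boundary, hence be
  -- empty or the whole cycle; both contradict the cardinality bounds.
  by_contra hlt
  have hM : M.card = 0 := by omega
  have hb : cyclicBoundary P = ∅ := by
    rw [← Finset.card_eq_zero]
    omega
  rcases em ((0 : ZMod n) ∈ P) with h0 | h0
  · have : P = Finset.univ := eq_of_cyclicBoundary_eq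
      (by rw [hb]; ext; simp [cyclicBoundary]) (by simpa using h0)
    have : P.card = n := by rw [this, Finset.card_univ, ZMod.card]
    omega
  · have : P = ∅ := eq_of_cyclicBoundary_eq
      (by rw [hb]; ext; simp [cyclicBoundary]) (by simpa using h0)
    rw [this, Finset.card_empty] at hMN hPQ
    omega

/-- A set violating expansion makes `π` compressing if its larger trace is on the first cycle, and
`π⁻¹` if it is on the second. -/
theorem prism_expansion (hn : 2 ≤ n) {π : Equiv.Perm (ZMod n)} (h1 : ¬ IsCompressing π)
    (h2 : ¬ IsCompressing π⁻¹) (S : Finset (ZMod n ⊕ ZMod n)) (hS : S.card ≤ n) :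
    S.card ≤ 200 * (openNeighbourhood (prism hn π) S).ncard := by
  classical
  by_contra hlt
  push Not at hlt
  let N : Finset (ZMod n ⊕ ZMod n) :=
    Finset.univ.filter (· ∈ openNeighbourhood (prism hn π) S)
  have hN : (openNeighbourhood (prism hn π) S).ncard = N.card := by
    rw [← Set.ncard_coe_finset]
    congr 1
    ext
    simp [N]
  have hmem : ∀ u v, u ∈ S → v ∉ S → prismAdj π u v → v ∈ N := fun u v hu hv huv => by
    simp only [N, Finset.mem_filter, Finset.mem_univ, true_and]
    exact ⟨hv, u, hu, huv⟩
  have hSc : S.toLeft.card + S.toRight.card = S.card := Finset.card_toLeft_add_card_toRight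
  have hNc : N.toLeft.card + N.toRight.card = N.card := Finset.card_toLeft_add_card_toRight
  rcases le_total S.toRight.card S.toLeft.card with h | h
  · refine h1 (isCompressing_of_small_boundary (P := S.toLeft) (Q := S.toRight) (M := N.toLeft)
      (N := N.toRight) h (by omega) ?_ ?_ ?_ ?_ ?_ (by omega))
    all_goals
      simp only [Finset.mem_toLeft, Finset.mem_toRight]
      intro i hi hi'
    · exact hmem _ _ hi hi' (.inl rfl)
    · exact hmem _ _ hi' hi (.inr rfl)
    · exact hmem _ _ hi hi' (.inl rfl)
    · exact hmem _ _ hi' hi (.inr rfl)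
    · exact hmem _ _ hi hi' rfl
  · refine h2 (isCompressing_of_small_boundary (P := S.toRight) (Q := S.toLeft) (M := N.toRight)
      (N := N.toLeft) h (by omega) ?_ ?_ ?_ ?_ ?_ (by omega))
    all_goals
      simp only [Finset.mem_toLeft, Finset.mem_toRight]
      intro i hi hi'
    · exact hmem _ _ hi hi' (.inl rfl)
    · exact hmem _ _ hi' hi (.inr rfl)
    · exact hmem _ _ hi hi' (.inl rfl)
    · exact hmem _ _ hi' hi (.inr rfl)
    · exact hmem _ _ hi hi' (π.apply_symm_apply i).symm

end Prism

/-! ### Relabelling vertices, and the final assembly -/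

section Transport

variable {U W : Type}

theorem ncard_neighborSet_comap (G : SimpleGraph W) (φ : U ≃ W) (v : U) :
    ((G.comap φ).neighborSet v).ncard = (G.neighborSet (φ v)).ncard := by
  have : (G.comap φ).neighborSet v = φ ⁻¹' G.neighborSet (φ v) := by
    ext; simp
  rw [this, Set.ncard_preimage_of_injective_subset_range φ.injective (by simp)]

theorem openNeighbourhood_comap (G : SimpleGraph W) (φ : U ≃ W) (S : Finset U) :
    openNeighbourhood (G.comap φ) S = φ ⁻¹' openNeighbourhood G (S.map φ.toEmbedding) := by
  ext v
  simp only [openNeighbourhood, Set.mem_preimage, Set.mem_ofPred_eq, SimpleGraph.comap_adj,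
    Finset.mem_map_equiv, Equiv.symm_apply_apply]
  refine and_congr_right fun _ => ⟨fun ⟨u, hu, h⟩ => ⟨φ u, by simpa using hu, h⟩,
    fun ⟨u, hu, h⟩ => ⟨φ.symm u, hu, by simpa using h⟩⟩

variable [Fintype U] [Fintype W]

theorem isCubic_of_ncard {G : SimpleGraph U} (h : ∀ v, (G.neighborSet v).ncard = 3) :
    IsCubic G := by
  classical
  intro v
  rw [← h v, ← SimpleGraph.card_neighborSet_eq_degree, ← Nat.card_eq_fintype_card,
    Nat.card_coe_set_eq]

theorem isExpander_comap [Nonempty U] {G : SimpleGraph W} (φ : U ≃ W) {e : ℝ} (he : 0 < e)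
    (h : ∀ v, (G.neighborSet v).ncard = 3)
    (hexp : ∀ S : Finset W, 2 * S.card ≤ Fintype.card W →
      e * S.card ≤ (openNeighbourhood G S).ncard) :
    IsExpander (G.comap φ) e 3 := by
  classical
  refine ⟨le_rfl, he, (isCubic_of_ncard fun v => ?_).maxDegree_eq, fun S hS => ?_⟩
  · rw [ncard_neighborSet_comap, h]
  · rw [openNeighbourhood_comap,
      Set.ncard_preimage_of_injective_subset_range φ.injective (by simp)]
    have := hexp (S.map φ.toEmbedding) (by
      rwa [Finset.card_map, ← Fintype.card_congr φ])
    rwa [Finset.card_map] at this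

end Transport

theorem exists_cubic_expander (n : ℕ) (hn : 3 ≤ n) :
    ∃ G : SimpleGraph (Finset.range (2 * n)),
      (∀ v, (G.neighborSet v).ncard = 3) ∧ IsExpander G (1 / 200) 3 := by
  have : NeZero n := ⟨by omega⟩
  obtain ⟨π, h1, h2⟩ := exists_perm_not_isCompressing (n := n)
  have hcard : Fintype.card (ZMod n ⊕ ZMod n) = 2 * n := by
    rw [Fintype.card_sum, ZMod.card]; ring
  let φ : Finset.range (2 * n) ≃ ZMod n ⊕ ZMod n :=
    Fintype.equivOfCardEq (by rw [hcard, Fintype.card_coe, Finset.card_range])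
  have : Nonempty (Finset.range (2 * n)) := ⟨φ.symm (.inl 0)⟩
  refine ⟨(prism (by omega) π).comap φ, fun v => ?_,
    isExpander_comap φ (by norm_num) (ncard_neighborSet_prism hn π) fun S hS => ?_⟩
  · rw [ncard_neighborSet_comap, ncard_neighborSet_prism hn]
  · rw [hcard] at hS
    have : (S.card : ℝ) ≤ 200 * (openNeighbourhood (prism (by omega) π) S).ncard := by
      exact_mod_cast prism_expansion (by omega) h1 h2 S (by omega)
    linarith

theorem mainTheorem1 :
    ∃ (𝒞 : Set (NNF ℕ)) (c : ℝ), 0 < c ∧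
      (∀ F ∈ 𝒞, (2 : ℝ) ^ (c * (F.size : ℝ)) ≤ (F.dnnfSize : ℝ)) ∧
      (∀ F ∈ 𝒞, F.IsReadTimes 3 ∧ F.IsMonotone ∧ F.IsKCNF 2) ∧
      ∃ (e : ℝ) (V : ℕ → Finset ℕ) (G : ∀ i, SimpleGraph (V i))
        (hV : ∀ i, 2 ≤ (V i).card) (hG : ∀ i v, ∃ w, (G i).Adj v w),
        (∀ i, IsCubic (G i) ∧ IsExpander (G i) e 3) ∧
        Filter.Tendsto (fun i => (V i).card) Filter.atTop Filter.atTop ∧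
        𝒞 = Set.range (fun i => graphCNF (G i) (hV i) (hG i)) := by
  choose G hdeg hexp using fun i : ℕ => exists_cubic_expander (i + 3) (by omega)
  have hV : ∀ i : ℕ, 2 ≤ (Finset.range (2 * (i + 3))).card := fun i => by
    rw [Finset.card_range]; omega
  have hG : ∀ i v, ∃ w, (G i).Adj v w := fun i v => by
    have : ((G i).neighborSet v).ncard ≠ 0 := by rw [hdeg]; norm_num
    exact Set.nonempty_of_ncard_ne_zero this
  -- For `d = 3` and `e = 1 / 200` the lower bound is `9 / 8` to the power `|V| / 2400`, and the
  -- size is at most `6 * |V|`; thus `14400 = 6 * 2400`.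
  refine ⟨Set.range fun i => graphCNF (G i) (hV i) (hG i), Real.logb 2 (9 / 8) / 14400, ?_, ?_, ?_,
    1 / 200, fun i => Finset.range (2 * (i + 3)), G, hV, hG,
    fun i => ⟨isCubic_of_ncard (hdeg i), hexp i⟩, ?_, rfl⟩
  · exact div_pos (Real.logb_pos (by norm_num) (by norm_num)) (by norm_num)
  · rintro _ ⟨i, rfl⟩
    refine le_trans ?_ (graphCNF_dnnfSize_ge (G i) (hV i) (hG i) (hexp i))
    have hsize : ((graphCNF (G i) (hV i) (hG i)).size : ℝ) ≤
        6 * (Finset.range (2 * (i + 3))).card := by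
      exact_mod_cast graphCNF_size_le (G i) (hV i) (hG i) fun v => (hdeg i v).le
    have hlog : 0 < Real.logb 2 (9 / 8) := Real.logb_pos (by norm_num) (by norm_num)
    have hbase : ((2 ^ 3 + 1) / 2 ^ 3 : ℝ) = 2 ^ Real.logb 2 (9 / 8) := by
      rw [Real.rpow_logb (by norm_num) (by norm_num) (by norm_num)]
      norm_num
    rw [hbase, ← Real.rpow_mul (by norm_num)]
    refine Real.rpow_le_rpow_of_exponent_le (by norm_num) ?_
    rw [div_mul_eq_mul_div, mul_div_assoc]
    refine mul_le_mul_of_nonneg_left ?_ hlog.le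
    push_cast
    linarith
  · rintro _ ⟨i, rfl⟩
    exact ⟨graphCNF_isReadTimes _ _ _ fun v => (hdeg i v).le, graphCNF_isMonotone _ _ _,
      graphCNF_isKCNF _ _ _⟩
  · simp only [Finset.card_range]
    exact Filter.tendsto_atTop_mono (fun i => show i ≤ 2 * (i + 3) by omega) Filter.tendsto_id
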